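/- Let $F$ be a field of characteristic different from $2$ (for instance a local field of odd or zero characteristic), let $E/F$ be a quadratic field extension with non-trivial automorphism $c$, and let $(W_1,\langle\cdot,\cdot\rangle_1)$ and $(W_2,\langle\cdot,\cdot\rangle_2)$ be (non-degenerate, $c$-sesquilinear) Hermitian spaces over $E$, both of dimension $d$. Let $W=W_1\oplus W_2$ be the orthogonal sum, $\sigma(w_1+w_2)=w_1-w_2$, let $\mathfrak u(W)$ be the Lie algebra of skew-Hermitian endomorphisms of $W$, and let $$\mathfrak u(W)_1=\{x\in\mathfrak u(W):\ \sigma x\sigma=-x\},$$ regarded as an algebraic variety over $F$, with the action of the algebraic group $U(W_1)\times U(W_2)\subset U(W)$ over $F$ by the restriction of the adjoint action (for a commutative $F$-algebra $R$, the $R$-points are formed from $W_i\otimes_F R$ with its $E\otimes_F R$-valued Hermitian form). Each $x\in\mathfrak u(W)_1$ is of the form $$x=\begin{pmatrix}0&X\\-X^*&0\end{pmatrix},\qquad X\in\mathrm{Hom}_E(W_2,W_1),\qquad \langle Xv,w\rangle_1=\langle v,X^*w\rangle_2;$$ put $r_1(x)=-XX^*\in\mathrm{End}(W_1)$, and let $a_i(x)$,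 for $1\le i\le d$, be the coefficient of $t^{i-1}$ in $\det(tI-r_1(x))$. Then the $a_i$ define a morphism $\pi=(a_1,\dots,a_d):\mathfrak u(W)_1\to\mathbb A^d$ of varieties over $F$ (the coefficients lie in $F$, and in $R$ on $R$-points), and $(\mathbb A^d,\pi)$ is a categorical quotient for the action of $U(W_1)\times U(W_2)$ on $\mathfrak u(W)_1$: the morphism $\pi$ is invariant, and for every $F$-scheme $Y$ and every invariant morphism $f:\mathfrak u(W)_1\to Y$ over $F$ there is a unique morphism $\varphi:\mathbb A^d\to Y$ over $F$ with $f=\varphi\circ\pi$. (A morphism $f$ is invariant if $f(g\cdot x)=f(x)$ for all $R$-points $g$ and $x$ and all commutative $F$-algebras $R$.) -/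

import Mathlib

open CategoryTheory
open scoped TensorProduct

universe u

noncomputable section

namespace UnitaryPair

/-! ## Categorical quotients, in terms of functors of points

For a field `F`, a scheme over `F` (or more generally a "space" over `F`) is seen through its functor
of points on commutative `F`-algebras, an embedding of `F`-schemes which is fully faithful. -/

section Quotient

variable {F : Type u} [Field F]

/-- The functor of points `R ↦ Hom_F(Spec R, Y)` of a scheme `Y` over `F`. -/
def schemePoints (Y : Over (AlgebraicGeometry.Spec (CommRingCat.of F))) :
    CommAlgCat.{u} F ⥤ Type u :=
  (AlgebraicGeometry.algSpec (CommRingCat.of F)).rightOp ⋙ yoneda.obj Y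

/-- The affine space `𝔸^d` over `F`, as the functor `R ↦ R^d`. -/
def affineSpace (F : Type u) [Field F] (d : ℕ) : CommAlgCat.{u} F ⥤ Type u where
  obj R := Fin d → R
  map φ := ↾fun a i => φ.hom (a i)

/-- An action of a group functor `G` on a functor `X` over `F`: an action of `G(R)` on `X(R)` for all
`R`, natural in `R`. -/
structure GroupAction (G : CommAlgCat.{u} F ⥤ GrpCat.{u}) (X : CommAlgCat.{u} F ⥤ Type u) where
  smul : ∀ R : CommAlgCat.{u} F, G.obj R → X.obj R → X.obj R
  one_smul : ∀ (R : CommAlgCat.{u} F) (x : X.obj R), smul R 1 x = x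
  mul_smul : ∀ (R : CommAlgCat.{u} F) (g h : G.obj R) (x : X.obj R),
    smul R (g * h) x = smul R g (smul R h x)
  map_smul : ∀ {R S : CommAlgCat.{u} F} (φ : R ⟶ S) (g : G.obj R) (x : X.obj R),
    X.map φ (smul R g x) = smul S (G.map φ g) (X.map φ x)

/-- A morphism `f` is invariant under the action of `G` if `f(g • x) = f(x)` for all points with
values in all commutative `F`-algebras. -/
def GroupAction.IsInvariant {G : CommAlgCat.{u} F ⥤ GrpCat.{u}} {X : CommAlgCat.{u} F ⥤ Type u}
    (a : GroupAction G X) {Y : CommAlgCat.{u} F ⥤ Type u} (f : X ⟶ Y) : Prop :=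
  ∀ (R : CommAlgCat.{u} F) (g : G.obj R) (x : X.obj R), f.app R (a.smul R g x) = f.app R x

/-- `π : X ⟶ Q` is a categorical quotient (in schemes over `F`) for the action of `G` on `X`: it is
invariant, and each invariant morphism from `X` to a scheme `Y` over `F` factors uniquely
through `π`. -/
structure GroupAction.IsCategoricalQuotient {G : CommAlgCat.{u} F ⥤ GrpCat.{u}}
    {X : CommAlgCat.{u} F ⥤ Type u} (a : GroupAction G X) {Q : CommAlgCat.{u} F ⥤ Type u}
    (π : X ⟶ Q) : Prop where
  invariant : a.IsInvariant π
  existsUnique_factor : ∀ (Y : Over (AlgebraicGeometry.Spec (CommRingCat.of F)))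
    (f : X ⟶ schemePoints Y), a.IsInvariant f → ∃! φ : Q ⟶ schemePoints Y, π ≫ φ = f

end Quotient

/-! ## Base change of Hermitian spaces -/

section BaseChange

variable {F E : Type u} [Field F] [Field E] [Algebra F E]
variable (R S T : Type u) [CommRing R] [Algebra F R] [CommRing S] [Algebra F S]
  [CommRing T] [Algebra F T]
variable (W W' W'' : Type u) [AddCommGroup W] [Module E W] [AddCommGroup W'] [Module E W']
  [AddCommGroup W''] [Module E W'']

variable (F E) in
/-- `W ⊗_F R`, as a module over `E ⊗_F R`. -/
abbrev Pts : Type u := (E ⊗[F] R) ⊗[E] W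

variable (F) in
/-- The base change to `E ⊗_F R` of an `E`-linear map. -/
abbrev extend {W W' : Type u} [AddCommGroup W] [Module E W] [AddCommGroup W'] [Module E W']
    (f : W →ₗ[E] W') : Pts F E R W →ₗ[E ⊗[F] R] Pts F E R W' :=
  f.baseChange (E ⊗[F] R)

/-- The conjugation `c ⊗ id` of `E ⊗_F R`. -/
def conj (c : E ≃ₐ[F] E) : E ⊗[F] R →+* E ⊗[F] R :=
  (Algebra.TensorProduct.map (c : E →ₐ[F] E) (AlgHom.id F R)).toRingHom

@[simp] lemma conj_tmul (c : E ≃ₐ[F] E) (e : E) (r : R) :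
    conj R c (e ⊗ₜ[F] r) = c e ⊗ₜ r := by
  simp [conj]

lemma conj_algebraMap (c : E ≃ₐ[F] E) (e : E) :
    conj R c (algebraMap E (E ⊗[F] R) e) = algebraMap E (E ⊗[F] R) (c e) := by
  simp [Algebra.TensorProduct.algebraMap_apply]

variable {W} in
/-- The value at `x ⊗ 1` in the first variable of the extended form. -/
def formAux {c : E ≃ₐ[F] E} (h : W →ₛₗ[(c : E →+* E)] W →ₗ[E] E) (x : W) :
    Pts F E R W →ₗ[E ⊗[F] R] E ⊗[F] R :=
  LinearMap.liftBaseChange (E ⊗[F] R) (Algebra.linearMap E (E ⊗[F] R) ∘ₗ h x)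

variable {W} in
/-- The sesquilinear form on `W ⊗_F R` with values in `E ⊗_F R` obtained from a sesquilinear form on
`W` by extension of scalars. -/
def form {c : E ≃ₐ[F] E} (h : W →ₛₗ[(c : E →+* E)] W →ₗ[E] E) :
    Pts F E R W →ₛₗ[conj R c] Pts F E R W →ₗ[E ⊗[F] R] E ⊗[F] R :=
  let f : Pts F E R W →ₛₗ[(c : E →+* E)] Pts F E R W →ₗ[E ⊗[F] R] E ⊗[F] R :=
    TensorProduct.lift (LinearMap.mk₂'ₛₗ (c : E →+* E) (c : E →+* E)
      (fun a x => conj R c a • formAux R h x)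
      (fun a b x => by simp [add_smul])
      (fun e a x => by
        rw [Algebra.smul_def, map_mul, conj_algebraMap, mul_smul, algebraMap_smul]
        rfl)
      (fun a x y => by
        ext
        simp [formAux, TensorProduct.add_tmul, mul_add])
      (fun e a x => by
        have hx : formAux R h (e • x) = algebraMap E (E ⊗[F] R) (c e) • formAux R h x := by
          ext
          simp only [formAux, map_smulₛₗ, TensorProduct.AlgebraTensorModule.curry_apply,
            TensorProduct.curry_apply, LinearMap.coe_restrictScalars, LinearMap.smul_apply,
            LinearMap.liftBaseChange_tmul, LinearMap.comp_apply, Algebra.linearMap_apply,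
            smul_eq_mul, map_mul, RingHom.coe_coe, one_mul]
        rw [hx, smul_comm, algebraMap_smul]
        rfl))
  { toFun := f
    map_add' := map_add f
    map_smul' := fun a u => by
      induction u using TensorProduct.induction_on with
      | zero => simp
      | add x y hx hy => simp [hx, hy]
      | tmul b x =>
        simp only [TensorProduct.smul_tmul', smul_eq_mul]
        simp [f, mul_smul] }

variable {W} in
lemma form_tmul {c : E ≃ₐ[F] E} (h : W →ₛₗ[(c : E →+* E)] W →ₗ[E] E) (a b : E ⊗[F] R) (x y : W) :
    form R h (a ⊗ₜ x) (b ⊗ₜ y) = conj R c a * (b * algebraMap E (E ⊗[F] R) (h x y)) := by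
  simp [form, formAux]

variable {R S T}

variable (E) in
/-- The map `W ⊗_F R → W ⊗_F S` induced by `φ : R → S`. -/
def push (φ : R →ₐ[F] S) : Pts F E R W →ₗ[E] Pts F E S W :=
  LinearMap.rTensor W (Algebra.TensorProduct.map (AlgHom.id E E) φ).toLinearMap

variable (E) in
/-- The ring homomorphism `E ⊗_F R → E ⊗_F S` induced by `φ : R → S`. -/
abbrev pushScalar (φ : R →ₐ[F] S) : E ⊗[F] R →ₐ[E] E ⊗[F] S :=
  Algebra.TensorProduct.map (AlgHom.id E E) φ

lemma push_tmul (φ : R →ₐ[F] S) (a : E ⊗[F] R) (x : W) :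
    push E W φ (a ⊗ₜ x) = pushScalar E φ a ⊗ₜ x := rfl

variable {W W' W''}

lemma push_smul (φ : R →ₐ[F] S) (a : E ⊗[F] R) (u : Pts F E R W) :
    push E W φ (a • u) = pushScalar E φ a • push E W φ u := by
  induction u using TensorProduct.induction_on with
  | zero => simp
  | add x y hx hy => simp [hx, hy]
  | tmul b x => simp [push_tmul, TensorProduct.smul_tmul']

lemma push_extend (φ : R →ₐ[F] S) (f : W →ₗ[E] W') (u : Pts F E R W) :
    push E W' φ (extend F R f u) = extend F S f (push E W φ u) := by
  induction u using TensorProduct.induction_on with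
  | zero => simp
  | add x y hx hy => simp only [map_add, hx, hy]
  | tmul b x => simp [push_tmul]

/-- The base change along `φ : R → S` of an endomorphism of `W ⊗_F R`. -/
def endMapFun (φ : R →ₐ[F] S) (x : Module.End (E ⊗[F] R) (Pts F E R W)) :
    Module.End (E ⊗[F] S) (Pts F E S W) :=
  LinearMap.liftBaseChange (E ⊗[F] S)
    (push E W φ ∘ₗ x.restrictScalars E ∘ₗ TensorProduct.mk E (E ⊗[F] R) W 1)

lemma endMapFun_push (φ : R →ₐ[F] S) (x : Module.End (E ⊗[F] R) (Pts F E R W))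
    (u : Pts F E R W) : endMapFun φ x (push E W φ u) = push E W φ (x u) := by
  induction u using TensorProduct.induction_on with
  | zero => simp
  | add x y hx hy => simp only [map_add, hx, hy]
  | tmul b w =>
    have : b ⊗ₜ[E] w = b • ((1 : E ⊗[F] R) ⊗ₜ[E] w) := by simp [TensorProduct.smul_tmul']
    rw [push_tmul, this, map_smul, push_smul]
    simp [endMapFun]

lemma hom_ext_push (φ : R →ₐ[F] S) {x y : Pts F E S W →ₗ[E ⊗[F] S] Pts F E S W'}
    (h : ∀ u : Pts F E R W, x (push E W φ u) = y (push E W φ u)) : x = y := by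
  ext w
  simpa [push_tmul] using h (1 ⊗ₜ w)

/-- The ring homomorphism `End(W ⊗_F R) → End(W ⊗_F S)` given by base change along `φ : R → S`;
it is characterized by `endMap_push` below. -/
def endMap (φ : R →ₐ[F] S) :
    Module.End (E ⊗[F] R) (Pts F E R W) →+* Module.End (E ⊗[F] S) (Pts F E S W) where
  toFun := endMapFun φ
  map_one' := hom_ext_push φ fun u => by simp [endMapFun_push]
  map_mul' x y := hom_ext_push φ fun u => by simp [endMapFun_push]
  map_zero' := hom_ext_push φ fun u => by simp [endMapFun_push]
  map_add' x y := hom_ext_push φ fun u => by simp [endMapFun_push]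

lemma endMap_push (φ : R →ₐ[F] S) (x : Module.End (E ⊗[F] R) (Pts F E R W))
    (u : Pts F E R W) : endMap φ x (push E W φ u) = push E W φ (x u) :=
  endMapFun_push φ x u

lemma push_id (u : Pts F E R W) : push E W (AlgHom.id F R) u = u := by
  simp [push]

lemma push_comp (φ : R →ₐ[F] S) (ψ : S →ₐ[F] T) (u : Pts F E R W) :
    push E W (ψ.comp φ) u = push E W ψ (push E W φ u) := by
  induction u using TensorProduct.induction_on with
  | zero => simp
  | add x y hx hy => simp only [map_add, hx, hy]
  | tmul b w =>
    simp only [push_tmul]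
    congr 1
    induction b using TensorProduct.induction_on with
    | zero => simp
    | add x y hx hy => simp only [map_add, hx, hy]
    | tmul e r => simp

lemma endMap_id (x : Module.End (E ⊗[F] R) (Pts F E R W)) :
    endMap (AlgHom.id F R) x = x :=
  hom_ext_push (AlgHom.id F R) fun u => by rw [endMap_push, push_id, push_id]

lemma endMap_comp (φ : R →ₐ[F] S) (ψ : S →ₐ[F] T) (x : Module.End (E ⊗[F] R) (Pts F E R W)) :
    endMap (ψ.comp φ) x = endMap ψ (endMap φ x) :=
  hom_ext_push (ψ.comp φ) fun u => by
    rw [endMap_push, push_comp, push_comp, endMap_push, endMap_push]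

lemma form_push {c : E ≃ₐ[F] E} (h : W →ₛₗ[(c : E →+* E)] W →ₗ[E] E) (φ : R →ₐ[F] S)
    (u v : Pts F E R W) :
    form S h (push E W φ u) (push E W φ v) = pushScalar E φ (form R h u v) := by
  have key : ∀ a : E ⊗[F] R, conj S c (pushScalar E φ a) = pushScalar E φ (conj R c a) := by
    intro a
    induction a using TensorProduct.induction_on with
    | zero => simp
    | add x y hx hy => simp only [map_add, hx, hy]
    | tmul e r => simp
  induction u using TensorProduct.induction_on with
  | zero => simp
  | add x y hx hy => simp only [map_add, LinearMap.add_apply, hx, hy]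
  | tmul a x =>
    induction v using TensorProduct.induction_on with
    | zero => simp
    | add x y hx hy => simp only [map_add, hx, hy]
    | tmul b y =>
      rw [push_tmul, push_tmul, form_tmul, form_tmul, key, map_mul, map_mul, AlgHom.commutes]

/-! ## Unitary groups and their Lie algebras -/

/-- The `R`-points of `𝔲(W)`: the endomorphisms of `W ⊗_F R` which are skew for the form. -/
def IsSkew {c : E ≃ₐ[F] E} (h : W →ₛₗ[(c : E →+* E)] W →ₗ[E] E)
    (x : Module.End (E ⊗[F] R) (Pts F E R W)) : Prop :=
  ∀ u v, form R h (x u) v + form R h u (x v) = 0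

/-- The `R`-points of `U(W)`: the automorphisms of `W ⊗_F R` which preserve the form. -/
def unitary (R : Type u) [CommRing R] [Algebra F R] {c : E ≃ₐ[F] E}
    (h : W →ₛₗ[(c : E →+* E)] W →ₗ[E] E) :
    Subgroup (Module.End (E ⊗[F] R) (Pts F E R W))ˣ where
  carrier := {g | ∀ u v, form R h (g.val u) (g.val v) = form R h u v}
  one_mem' := fun u v => by simp
  mul_mem' := fun {a b} ha hb u v => by
    rw [Units.val_mul, Module.End.mul_apply, Module.End.mul_apply, ha, hb]
  inv_mem' := fun {a} ha u v => by
    have hi : ∀ w, a.val (a⁻¹.val w) = w := fun w => by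
      rw [← Module.End.mul_apply, Units.mul_inv]; rfl
    have := ha (a⁻¹.val u) (a⁻¹.val v)
    rw [hi, hi] at this
    exact this.symm

lemma form_ext_push (φ : R →ₐ[F] S) {N : Type u} [AddCommGroup N] [Module (E ⊗[F] S) N]
    {σ : E ⊗[F] S →+* E ⊗[F] S}
    {A B : Pts F E S W →ₛₗ[σ] Pts F E S W →ₗ[E ⊗[F] S] N}
    (h : ∀ u v : Pts F E R W, A (push E W φ u) (push E W φ v) = B (push E W φ u) (push E W φ v)) :
    A = B := by
  have span : ∀ (a : E ⊗[F] S) (w : W), a ⊗ₜ[E] w = a • push E W φ ((1 : E ⊗[F] R) ⊗ₜ w) := by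
    intro a w
    rw [push_tmul, map_one]
    simp [TensorProduct.smul_tmul']
  apply LinearMap.ext
  intro u
  apply LinearMap.ext
  intro v
  induction u using TensorProduct.induction_on with
  | zero => simp
  | add x y hx hy => simp only [map_add, LinearMap.add_apply, hx, hy]
  | tmul a x =>
    induction v using TensorProduct.induction_on with
    | zero => simp
    | add x y hx hy => simp only [map_add, hx, hy]
    | tmul b y =>
      rw [span a x, span b y]
      simp only [LinearMap.map_smulₛₗ, LinearMap.smul_apply, h]

lemma IsSkew.endMap {c : E ≃ₐ[F] E} {h : W →ₛₗ[(c : E →+* E)] W →ₗ[E] E}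
    {x : Module.End (E ⊗[F] R) (Pts F E R W)} (hx : IsSkew h x) (φ : R →ₐ[F] S) :
    IsSkew h (endMap φ x) := by
  have := form_ext_push φ (A := (form S h).comp (UnitaryPair.endMap φ x) +
    (form S h).compl₂ (UnitaryPair.endMap φ x)) (B := 0) (fun u v => by
      simp [endMap_push, form_push, ← map_add, hx u v])
  intro u v
  simpa using LinearMap.congr_fun₂ this u v

lemma unitary_endMap {c : E ≃ₐ[F] E} {h : W →ₛₗ[(c : E →+* E)] W →ₗ[E] E}
    (φ : R →ₐ[F] S) {g : (Module.End (E ⊗[F] R) (Pts F E R W))ˣ} (hg : g ∈ unitary R h) :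
    Units.map (endMap φ).toMonoidHom g ∈ unitary S h := by
  have := form_ext_push φ (A := ((form S h).comp (endMap φ g.val)).compl₂ (endMap φ g.val))
    (B := form S h) (fun u v => by
      simp [endMap_push, form_push, hg u v])
  intro u v
  simpa using LinearMap.congr_fun₂ this u v

/-- The homomorphism `U(W)(R) → U(W)(S)` induced by `φ : R → S`. -/
def unitaryMap {c : E ≃ₐ[F] E} (h : W →ₛₗ[(c : E →+* E)] W →ₗ[E] E) (φ : R →ₐ[F] S) :
    unitary R h →* unitary S h :=
  ((Units.map (endMap φ).toMonoidHom).comp (unitary R h).subtype).codRestrict (unitary S h)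
    fun g => unitary_endMap φ g.2

end BaseChange

/-! ## The symmetric pair attached to `W = W₁ ⊕ W₂` -/

section Pair

variable {F E : Type u} [Field F] [Field E] [Algebra F E]
variable {R S : Type u} [CommRing R] [Algebra F R] [CommRing S] [Algebra F S]
variable {W₁ W₂ : Type u} [AddCommGroup W₁] [Module E W₁] [AddCommGroup W₂] [Module E W₂]
variable {c : E ≃ₐ[F] E}

/-- The orthogonal sum of the forms on `W₁` and `W₂`, a form on `W = W₁ ⊕ W₂`. -/
def sumForm (h₁ : W₁ →ₛₗ[(c : E →+* E)] W₁ →ₗ[E] E) (h₂ : W₂ →ₛₗ[(c : E →+* E)] W₂ →ₗ[E] E) :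
    (W₁ × W₂) →ₛₗ[(c : E →+* E)] (W₁ × W₂) →ₗ[E] E :=
  LinearMap.mk₂'ₛₗ (c : E →+* E) (RingHom.id E) (fun x y => h₁ x.1 y.1 + h₂ x.2 y.2)
    (fun x y z => by simp; abel) (fun e x y => by simp [mul_add])
    (fun x y z => by simp; abel) (fun e x y => by simp [mul_add])

variable (E W₁ W₂) in
/-- The involution `(w₁, w₂) ↦ (w₁, -w₂)` of `W`. -/
def invol : W₁ × W₂ →ₗ[E] W₁ × W₂ := LinearMap.prodMap LinearMap.id (-LinearMap.id)

variable (F E R W₁ W₂) in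
/-- The first inclusion `W₁ ⊗_F R → W ⊗_F R`. -/
abbrev inj₁ := extend F R (LinearMap.inl E W₁ W₂)
variable (F E R W₁ W₂) in
/-- The second inclusion `W₂ ⊗_F R → W ⊗_F R`. -/
abbrev inj₂ := extend F R (LinearMap.inr E W₁ W₂)
variable (F E R W₁ W₂) in
/-- The first projection `W ⊗_F R → W₁ ⊗_F R`. -/
abbrev proj₁ := extend F R (LinearMap.fst E W₁ W₂)
variable (F E R W₁ W₂) in
/-- The second projection `W ⊗_F R → W₂ ⊗_F R`. -/
abbrev proj₂ := extend F R (LinearMap.snd E W₁ W₂)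

/-- The `R`-points of `𝔲(W)_1`: the `(-1)`-eigenspace in `𝔲(W)` of `x ↦ σ ∘ x ∘ σ`, where `σ` is the
involution of `W`. -/
def oddPart (R : Type u) [CommRing R] [Algebra F R]
    (h₁ : W₁ →ₛₗ[(c : E →+* E)] W₁ →ₗ[E] E) (h₂ : W₂ →ₛₗ[(c : E →+* E)] W₂ →ₗ[E] E) :
    Set (Module.End (E ⊗[F] R) (Pts F E R (W₁ × W₂))) :=
  {x | IsSkew (sumForm h₁ h₂) x ∧ extend F R (invol E W₁ W₂) * x * extend F R (invol E W₁ W₂) = -x}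

/-- The upper right block `X : W₂ → W₁` of an endomorphism of `W = W₁ ⊕ W₂`. -/
def block₁₂ (x : Module.End (E ⊗[F] R) (Pts F E R (W₁ × W₂))) :
    Pts F E R W₂ →ₗ[E ⊗[F] R] Pts F E R W₁ :=
  proj₁ F E R W₁ W₂ ∘ₗ x ∘ₗ inj₂ F E R W₁ W₂

/-- The lower left block `W₁ → W₂` of an endomorphism of `W = W₁ ⊕ W₂`; for `x` in `𝔲(W)_1` it is
`-X^*`, with `X` the upper right block and `X^*` its adjoint, see `block_adjoint`. -/
def block₂₁ (x : Module.End (E ⊗[F] R) (Pts F E R (W₁ × W₂))) :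
    Pts F E R W₁ →ₗ[E ⊗[F] R] Pts F E R W₂ :=
  proj₂ F E R W₁ W₂ ∘ₗ x ∘ₗ inj₁ F E R W₁ W₂

/-- The contraction `r₁(x) = -X X^*`, an endomorphism of `W₁ ⊗_F R`. -/
def contraction (x : Module.End (E ⊗[F] R) (Pts F E R (W₁ × W₂))) :
    Module.End (E ⊗[F] R) (Pts F E R W₁) :=
  block₁₂ x ∘ₗ block₂₁ x

lemma form_sum (h₁ : W₁ →ₛₗ[(c : E →+* E)] W₁ →ₗ[E] E) (h₂ : W₂ →ₛₗ[(c : E →+* E)] W₂ →ₗ[E] E)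
    (u v : Pts F E R (W₁ × W₂)) :
    form R (sumForm h₁ h₂) u v =
      form R h₁ (proj₁ F E R W₁ W₂ u) (proj₁ F E R W₁ W₂ v) +
        form R h₂ (proj₂ F E R W₁ W₂ u) (proj₂ F E R W₁ W₂ v) := by
  induction u using TensorProduct.induction_on with
  | zero => simp
  | add x y hx hy => simp only [map_add, LinearMap.add_apply, hx, hy]; abel
  | tmul a x =>
    induction v using TensorProduct.induction_on with
    | zero => simp
    | add x y hx hy => simp only [map_add, hx, hy]; abel
    | tmul b y =>
      simp [form_tmul, sumForm, TensorProduct.add_tmul, mul_add]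

lemma proj₁_inj₁ (u : Pts F E R W₁) : proj₁ F E R W₁ W₂ (inj₁ F E R W₁ W₂ u) = u := by
  rw [← LinearMap.comp_apply, ← LinearMap.baseChange_comp, LinearMap.fst_comp_inl]; simp

lemma proj₂_inj₂ (u : Pts F E R W₂) : proj₂ F E R W₁ W₂ (inj₂ F E R W₁ W₂ u) = u := by
  rw [← LinearMap.comp_apply, ← LinearMap.baseChange_comp, LinearMap.snd_comp_inr]; simp

lemma proj₁_inj₂ (u : Pts F E R W₂) : proj₁ F E R W₁ W₂ (inj₂ F E R W₁ W₂ u) = 0 := by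
  rw [← LinearMap.comp_apply, ← LinearMap.baseChange_comp, LinearMap.fst_comp_inr]; simp

lemma proj₂_inj₁ (u : Pts F E R W₁) : proj₂ F E R W₁ W₂ (inj₁ F E R W₁ W₂ u) = 0 := by
  rw [← LinearMap.comp_apply, ← LinearMap.baseChange_comp, LinearMap.snd_comp_inl]; simp

lemma inj_proj (u : Pts F E R (W₁ × W₂)) :
    inj₁ F E R W₁ W₂ (proj₁ F E R W₁ W₂ u) + inj₂ F E R W₁ W₂ (proj₂ F E R W₁ W₂ u) = u := by
  induction u using TensorProduct.induction_on with
  | zero => simp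
  | add x y hx hy =>
    nth_rw 3 [← hx, ← hy]
    simp only [map_add]
    abel
  | tmul a x => simp [← TensorProduct.tmul_add]

/-- The lower left block of an element of `𝔲(W)_1` is `-X^*`: `⟨X v, w⟩₁ = ⟨v, X^* w⟩₂`. -/
lemma block_adjoint {h₁ : W₁ →ₛₗ[(c : E →+* E)] W₁ →ₗ[E] E}
    {h₂ : W₂ →ₛₗ[(c : E →+* E)] W₂ →ₗ[E] E}
    {x : Module.End (E ⊗[F] R) (Pts F E R (W₁ × W₂))} (hx : x ∈ oddPart R h₁ h₂)
    (v : Pts F E R W₂) (w : Pts F E R W₁) :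
    form R h₁ (block₁₂ x v) w = form R h₂ v ((-block₂₁ x) w) := by
  have := hx.1 (inj₂ F E R W₁ W₂ v) (inj₁ F E R W₁ W₂ w)
  rw [form_sum, form_sum, proj₁_inj₁, proj₂_inj₂, proj₁_inj₂, proj₂_inj₁] at this
  simp only [map_zero, LinearMap.zero_apply, zero_add, add_zero] at this
  rw [LinearMap.neg_apply, map_neg]
  exact eq_neg_of_add_eq_zero_left this

/-- The map `𝔲(W)_1(R) → 𝔲(W)_1(S)` induced by `φ : R → S`. -/
def oddMap (h₁ : W₁ →ₛₗ[(c : E →+* E)] W₁ →ₗ[E] E) (h₂ : W₂ →ₛₗ[(c : E →+* E)] W₂ →ₗ[E] E)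
    (φ : R →ₐ[F] S) (x : oddPart R h₁ h₂) : oddPart S h₁ h₂ :=
  ⟨endMap φ x.1, x.2.1.endMap φ, by
    have key : endMap φ (extend F R (invol E W₁ W₂)) = extend F S (invol E W₁ W₂) :=
      hom_ext_push φ fun u => by rw [endMap_push, push_extend]
    rw [← key, ← map_mul, ← map_mul, x.2.2]
    exact map_neg (endMap φ) x.1⟩

/-- The functor of points of `𝔲(W)_1`. -/
def oddFunctor (h₁ : W₁ →ₛₗ[(c : E →+* E)] W₁ →ₗ[E] E) (h₂ : W₂ →ₛₗ[(c : E →+* E)] W₂ →ₗ[E] E) :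
    CommAlgCat.{u} F ⥤ Type u where
  obj R := oddPart R h₁ h₂
  map φ := ↾oddMap h₁ h₂ φ.hom
  map_id R := ConcreteCategory.hom_ext _ _ fun (x : oddPart R h₁ h₂) => Subtype.ext (endMap_id x.1)
  map_comp {R _ _} φ ψ := ConcreteCategory.hom_ext _ _ fun (x : oddPart R h₁ h₂) =>
    Subtype.ext (endMap_comp φ.hom ψ.hom x.1)

/-- The group functor `U(W₁) × U(W₂)`. -/
def unitaryProd (h₁ : W₁ →ₛₗ[(c : E →+* E)] W₁ →ₗ[E] E)
    (h₂ : W₂ →ₛₗ[(c : E →+* E)] W₂ →ₗ[E] E) : CommAlgCat.{u} F ⥤ GrpCat.{u} where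
  obj R := GrpCat.of (unitary R h₁ × unitary R h₂)
  map φ := GrpCat.ofHom ((unitaryMap h₁ φ.hom).prodMap (unitaryMap h₂ φ.hom))
  map_id _ := GrpCat.hom_ext (MonoidHom.ext fun g =>
    Prod.ext (Subtype.ext (Units.ext (endMap_id g.1.1.val)))
      (Subtype.ext (Units.ext (endMap_id g.2.1.val))))
  map_comp φ ψ := GrpCat.hom_ext (MonoidHom.ext fun g =>
    Prod.ext (Subtype.ext (Units.ext (endMap_comp φ.hom ψ.hom g.1.1.val)))
      (Subtype.ext (Units.ext (endMap_comp φ.hom ψ.hom g.2.1.val))))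

/-- The block diagonal endomorphism of `W ⊗_F R` with blocks `a` and `b`. -/
def blockDiag : Module.End (E ⊗[F] R) (Pts F E R W₁) × Module.End (E ⊗[F] R) (Pts F E R W₂) →*
    Module.End (E ⊗[F] R) (Pts F E R (W₁ × W₂)) where
  toFun g := inj₁ F E R W₁ W₂ ∘ₗ g.1 ∘ₗ proj₁ F E R W₁ W₂ +
    inj₂ F E R W₁ W₂ ∘ₗ g.2 ∘ₗ proj₂ F E R W₁ W₂
  map_one' := LinearMap.ext fun u => inj_proj u
  map_mul' g h := LinearMap.ext fun u => by
    simp only [LinearMap.add_apply, LinearMap.comp_apply, Module.End.mul_apply, Prod.fst_mul,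
      Prod.snd_mul, map_add, proj₁_inj₁, proj₁_inj₂, proj₂_inj₁, proj₂_inj₂, map_zero, zero_add,
      add_zero]

/-- The embedding of `U(W₁) × U(W₂)` into the automorphisms of `W ⊗_F R`. -/
def pairEmb (R : Type u) [CommRing R] [Algebra F R] (h₁ : W₁ →ₛₗ[(c : E →+* E)] W₁ →ₗ[E] E)
    (h₂ : W₂ →ₛₗ[(c : E →+* E)] W₂ →ₗ[E] E) :
    unitary R h₁ × unitary R h₂ →* (Module.End (E ⊗[F] R) (Pts F E R (W₁ × W₂)))ˣ :=
  (Units.map blockDiag).comp (MulEquiv.prodUnits.symm.toMonoidHom.comp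
    ((unitary R h₁).subtype.prodMap (unitary R h₂).subtype))

lemma pairEmb_val (h₁ : W₁ →ₛₗ[(c : E →+* E)] W₁ →ₗ[E] E)
    (h₂ : W₂ →ₛₗ[(c : E →+* E)] W₂ →ₗ[E] E) (g : unitary R h₁ × unitary R h₂) :
    (pairEmb R h₁ h₂ g).val = blockDiag (g.1.1.val, g.2.1.val) := rfl

/-- `U(W₁) × U(W₂)` is contained in `U(W)`. -/
lemma pairEmb_mem (h₁ : W₁ →ₛₗ[(c : E →+* E)] W₁ →ₗ[E] E)
    (h₂ : W₂ →ₛₗ[(c : E →+* E)] W₂ →ₗ[E] E) (g : unitary R h₁ × unitary R h₂) :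
    pairEmb R h₁ h₂ g ∈ unitary R (sumForm h₁ h₂) := by
  intro u v
  have e₁ := g.1.2 (proj₁ F E R W₁ W₂ u) (proj₁ F E R W₁ W₂ v)
  have e₂ := g.2.2 (proj₂ F E R W₁ W₂ u) (proj₂ F E R W₁ W₂ v)
  rw [form_sum, form_sum, ← e₁, ← e₂, pairEmb_val]
  simp only [blockDiag, MonoidHom.coe_mk, OneHom.coe_mk, LinearMap.add_apply,
    LinearMap.comp_apply, map_add, proj₁_inj₁, proj₁_inj₂, proj₂_inj₁, proj₂_inj₂, zero_add,
    add_zero]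

lemma blockDiag_invol (g : Module.End (E ⊗[F] R) (Pts F E R W₁) ×
    Module.End (E ⊗[F] R) (Pts F E R W₂)) :
    blockDiag g * extend F R (invol E W₁ W₂) = extend F R (invol E W₁ W₂) * blockDiag g := by
  have p₁ : ∀ u, proj₁ F E R W₁ W₂ (extend F R (invol E W₁ W₂) u) = proj₁ F E R W₁ W₂ u := by
    intro u
    rw [← LinearMap.comp_apply, ← LinearMap.baseChange_comp]; rfl
  have p₂ : ∀ u, proj₂ F E R W₁ W₂ (extend F R (invol E W₁ W₂) u) = -proj₂ F E R W₁ W₂ u := by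
    intro u
    rw [← LinearMap.comp_apply, ← LinearMap.baseChange_comp, ← LinearMap.neg_apply,
      ← LinearMap.baseChange_neg]; rfl
  have i₁ : ∀ u, extend F R (invol E W₁ W₂) (inj₁ F E R W₁ W₂ u) = inj₁ F E R W₁ W₂ u := by
    intro u
    rw [← LinearMap.comp_apply, ← LinearMap.baseChange_comp]
    congr 2
    ext w <;> simp [invol]
  have i₂ : ∀ u, extend F R (invol E W₁ W₂) (inj₂ F E R W₁ W₂ u) = -inj₂ F E R W₁ W₂ u := by
    intro u
    rw [← LinearMap.comp_apply, ← LinearMap.baseChange_comp, ← LinearMap.neg_apply,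
      ← LinearMap.baseChange_neg]
    congr 2
    ext w <;> simp [invol]
  apply LinearMap.ext
  intro u
  simp only [blockDiag, MonoidHom.coe_mk, OneHom.coe_mk, Module.End.mul_apply,
    LinearMap.add_apply, LinearMap.comp_apply, map_add, map_neg, p₁, p₂, i₁, i₂]

lemma endMap_blockDiag (φ : R →ₐ[F] S) (g : Module.End (E ⊗[F] R) (Pts F E R W₁) ×
    Module.End (E ⊗[F] R) (Pts F E R W₂)) :
    endMap φ (blockDiag g) = blockDiag (endMap φ g.1, endMap φ g.2) :=
  hom_ext_push φ fun u => by
    simp only [endMap_push, blockDiag, MonoidHom.coe_mk, OneHom.coe_mk, LinearMap.add_apply,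
      LinearMap.comp_apply, map_add, push_extend φ (LinearMap.inl E W₁ W₂),
      push_extend φ (LinearMap.inr E W₁ W₂), ← push_extend φ (LinearMap.fst E W₁ W₂),
      ← push_extend φ (LinearMap.snd E W₁ W₂)]

/-- The action of `U(W₁) × U(W₂)` on `𝔲(W)_1(R)` by restriction of the adjoint action of `U(W)`. -/
def adjoint (h₁ : W₁ →ₛₗ[(c : E →+* E)] W₁ →ₗ[E] E) (h₂ : W₂ →ₛₗ[(c : E →+* E)] W₂ →ₗ[E] E)
    (g : unitary R h₁ × unitary R h₂) (x : oddPart R h₁ h₂) : oddPart R h₁ h₂ :=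
  ⟨(pairEmb R h₁ h₂ g).val * x.1 * (pairEmb R h₁ h₂ g⁻¹).val, by
    have hm := pairEmb_mem h₁ h₂ g
    have hi : ∀ w, (pairEmb R h₁ h₂ g).val ((pairEmb R h₁ h₂ g⁻¹).val w) = w := fun w => by
      rw [← Module.End.mul_apply, ← Units.val_mul, ← map_mul, mul_inv_cancel, map_one]; rfl
    constructor
    · intro u v
      have e := x.2.1 ((pairEmb R h₁ h₂ g⁻¹).val u) ((pairEmb R h₁ h₂ g⁻¹).val v)
      rw [← hm, ← hm ((pairEmb R h₁ h₂ g⁻¹).val u), hi, hi] at e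
      exact e
    · have s₁ : (pairEmb R h₁ h₂ g).val * extend F R (invol E W₁ W₂) =
          extend F R (invol E W₁ W₂) * (pairEmb R h₁ h₂ g).val := blockDiag_invol _
      have s₂ : (pairEmb R h₁ h₂ g⁻¹).val * extend F R (invol E W₁ W₂) =
          extend F R (invol E W₁ W₂) * (pairEmb R h₁ h₂ g⁻¹).val := blockDiag_invol _
      have e := x.2.2
      calc _ = (extend F R (invol E W₁ W₂) * (pairEmb R h₁ h₂ g).val) * x.1 *
            ((pairEmb R h₁ h₂ g⁻¹).val * extend F R (invol E W₁ W₂)) := by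
            simp only [mul_assoc]
        _ = (pairEmb R h₁ h₂ g).val * (extend F R (invol E W₁ W₂) * x.1 *
            extend F R (invol E W₁ W₂)) * (pairEmb R h₁ h₂ g⁻¹).val := by
          rw [← s₁, s₂]; simp only [mul_assoc]
        _ = _ := by
          rw [e]
          exact LinearMap.ext fun u => by
            simp only [Module.End.mul_apply, LinearMap.neg_apply, map_neg]⟩

lemma endMap_pairEmb (h₁ : W₁ →ₛₗ[(c : E →+* E)] W₁ →ₗ[E] E)
    (h₂ : W₂ →ₛₗ[(c : E →+* E)] W₂ →ₗ[E] E) (φ : R →ₐ[F] S) (g : unitary R h₁ × unitary R h₂) :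
    endMap φ (pairEmb R h₁ h₂ g).val =
      (pairEmb S h₁ h₂ ((unitaryMap h₁ φ).prodMap (unitaryMap h₂ φ) g)).val :=
  endMap_blockDiag φ (g.1.1.val, g.2.1.val)

lemma adjoint_one (h₁ : W₁ →ₛₗ[(c : E →+* E)] W₁ →ₗ[E] E)
    (h₂ : W₂ →ₛₗ[(c : E →+* E)] W₂ →ₗ[E] E)
    (x : oddPart R h₁ h₂) : adjoint h₁ h₂ 1 x = x := Subtype.ext (by
  change (pairEmb R h₁ h₂ 1).val * x.1 * (pairEmb R h₁ h₂ 1⁻¹).val = x.1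
  rw [inv_one, map_one, Units.val_one, one_mul, mul_one])

lemma adjoint_mul (h₁ : W₁ →ₛₗ[(c : E →+* E)] W₁ →ₗ[E] E)
    (h₂ : W₂ →ₛₗ[(c : E →+* E)] W₂ →ₗ[E] E)
    (a b : unitary R h₁ × unitary R h₂) (x : oddPart R h₁ h₂) :
    adjoint h₁ h₂ (a * b) x = adjoint h₁ h₂ a (adjoint h₁ h₂ b x) := Subtype.ext (by
  change (pairEmb R h₁ h₂ (a * b)).val * x.1 * (pairEmb R h₁ h₂ (a * b)⁻¹).val =
    (pairEmb R h₁ h₂ a).val * ((pairEmb R h₁ h₂ b).val * x.1 * (pairEmb R h₁ h₂ b⁻¹).val) *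
      (pairEmb R h₁ h₂ a⁻¹).val
  rw [mul_inv_rev, map_mul, map_mul, Units.val_mul, Units.val_mul]
  simp only [mul_assoc])

lemma oddMap_adjoint (h₁ : W₁ →ₛₗ[(c : E →+* E)] W₁ →ₗ[E] E)
    (h₂ : W₂ →ₛₗ[(c : E →+* E)] W₂ →ₗ[E] E)
    (φ : R →ₐ[F] S) (a : unitary R h₁ × unitary R h₂) (x : oddPart R h₁ h₂) :
    oddMap h₁ h₂ φ (adjoint h₁ h₂ a x) =
      adjoint h₁ h₂ ((unitaryMap h₁ φ).prodMap (unitaryMap h₂ φ) a) (oddMap h₁ h₂ φ x) :=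
  Subtype.ext (by
    change endMap φ ((pairEmb R h₁ h₂ a).val * x.1 * (pairEmb R h₁ h₂ a⁻¹).val) =
      (pairEmb S h₁ h₂ ((unitaryMap h₁ φ).prodMap (unitaryMap h₂ φ) a)).val * endMap φ x.1 *
        (pairEmb S h₁ h₂ ((unitaryMap h₁ φ).prodMap (unitaryMap h₂ φ) a)⁻¹).val
    rw [map_mul, map_mul, endMap_pairEmb, endMap_pairEmb, map_inv])

/-- The action of the group functor `U(W₁) × U(W₂)` on the functor of points of `𝔲(W)_1`. -/
def adjointAction (h₁ : W₁ →ₛₗ[(c : E →+* E)] W₁ →ₗ[E] E)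
    (h₂ : W₂ →ₛₗ[(c : E →+* E)] W₂ →ₗ[E] E) :
    GroupAction (unitaryProd h₁ h₂) (oddFunctor h₁ h₂) where
  smul R g x := adjoint (R := R) h₁ h₂ g x
  one_smul R x := adjoint_one (R := R) h₁ h₂ x
  mul_smul R g g' x := adjoint_mul (R := R) h₁ h₂ g g' x
  map_smul {R S} φ g x := oddMap_adjoint (R := R) (S := S) h₁ h₂ φ.hom g x

end Pair

end UnitaryPair

end

/-! Let `R` be an `F`-algebra with an embedding `ι : E → R`. As `2` is invertible, `E ⊗ R` is `R ×
R`, with the conjugation exchanging the factors. The Hermitian structure then disappears: a point of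
the odd part is an arbitrary pair `(A, B)` of `d × d` matrices (`coord_ext`, `exists_coord`), the
group is `GL_d × GL_d` (`exists_unitary_coord`) acting by `(P A Q⁻¹, Q B P⁻¹)`, and `π` records the
characteristic polynomial of `A B`.

Over an algebraically closed field `K`, an invariant morphism `f` to a scheme `Y` is constant on the
fibres of `π`. If a family over `K⟦X⟧` is equivalent over the fraction field to a constant pair,
then `f` is generically constant on it, hence constant (`points_specialize`); this works for every
`Y` because the spectrum of a local ring maps into an affine open. Such degenerations lead from `(A,
B)` to a triangular pair, then to a diagonal pair, and connect that one with `(diag l, 1)`, where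
`l` lists the eigenvalues of `A B` (`IsDegenerationInvariant.eq_of_charpoly_eq`).

Let `𝒪` be the polynomial ring of `𝔸^d` and `B = 𝒪 ⊗ E`. A matrix `M` over `B` with the universal
characteristic polynomial gives the point `s = (M, 1)`, a section of `π` over `B`
(`exists_section`). The value `f(s)` descends along the faithfully flat map `𝒪 → B`: the ring `B ⊗_𝒪
B` is reduced, so the descent condition is tested on geometric points, where it is constancy on
fibres. The descended point is the factorization `φ`. The identity `f = φ ∘ π` is again tested on
geometric points, since every point of the odd part lifts to a reduced algebra
(`oddFunctor_hom_ext`). Uniqueness follows by evaluation at `s`. -/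

noncomputable section

namespace UnitaryPair

/-! ## Morphisms from affine schemes -/

section Schemes

open AlgebraicGeometry Limits

/-- Morphisms from a reduced affine scheme are determined by their values at points over
algebraically closed fields. -/
lemma spec_hom_ext_of_isAlgClosed {A : Type u} [CommRing A] [IsReduced A] {Y : Scheme.{u}}
    {f g : Spec (CommRingCat.of A) ⟶ Y}
    (H : ∀ (K : Type u) [Field K] [IsAlgClosed K] (φ : A →+* K),
      Spec.map (CommRingCat.ofHom φ) ≫ f = Spec.map (CommRingCat.ofHom φ) ≫ g) : f = g := by
  have hx : ∀ x : Spec (CommRingCat.of A),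
      (Spec (CommRingCat.of A)).fromSpecResidueField x ≫ f =
        (Spec (CommRingCat.of A)).fromSpecResidueField x ≫ g := by
    intro x
    let k := (Spec (CommRingCat.of A)).residueField x
    let j : k →+* AlgebraicClosure k := algebraMap _ _
    -- The spectrum of a field extension is flat and surjective, hence an epimorphism, so agreement
    -- over the algebraic closure gives agreement over the residue field.
    have hflat : Flat (Spec.map (CommRingCat.ofHom j)) := by
      rw [Flat.SpecMap_iff, CommRingCat.hom_ofHom, RingHom.flat_algebraMap_iff]
      infer_instance
    have hepi : Epi (Spec.map (CommRingCat.ofHom j)) := Flat.epi_of_flat_of_surjective _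
    rw [← cancel_epi (Spec.map (CommRingCat.ofHom j)), ← Category.assoc, ← Category.assoc]
    have := H (AlgebraicClosure k) (Spec.preimage (Spec.map (CommRingCat.ofHom j) ≫
      (Spec (CommRingCat.of A)).fromSpecResidueField x)).hom
    rwa [CommRingCat.ofHom_hom, Spec.map_preimage] at this
  have hs : Surjective (equalizer.ι f g) := ⟨fun x => ⟨equalizer.lift _ (hx x) default, by
    rw [← Scheme.Hom.comp_apply, equalizer.lift_ι, Scheme.fromSpecResidueField_apply]⟩⟩
  -- As `Y` need not be separated, the equalizer is a priori only an immersion; surjectivity makes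
  -- its range closed, and a surjective closed immersion into a reduced scheme is an isomorphism.
  have hc : IsClosedImmersion (equalizer.ι f g) := .of_isPreimmersion _ (by
    rw [Set.range_eq_univ.mpr hs.surj]
    exact isClosed_univ)
  have := isIso_of_isClosedImmersion_of_surjective (equalizer.ι f g)
  rw [← cancel_epi (equalizer.ι f g)]
  exact equalizer.condition f g

/-- Morphisms which do not separate points of `B` over algebraically closed fields with the same
image in `A` descend from `B` to `A`. -/
lemma exists_spec_descent {A B : Type u} [CommRing A] [CommRing B] [Algebra A B]
    [Module.FaithfullyFlat A B] [IsReduced (B ⊗[A] B)] {Y : Scheme.{u}}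
    (f : Spec (CommRingCat.of B) ⟶ Y)
    (H : ∀ (K : Type u) [Field K] [IsAlgClosed K] (φ ψ : B →+* K),
      φ.comp (algebraMap A B) = ψ.comp (algebraMap A B) →
        Spec.map (CommRingCat.ofHom φ) ≫ f = Spec.map (CommRingCat.ofHom ψ) ≫ f) :
    ∃ g : Spec (CommRingCat.of A) ⟶ Y, Spec.map (CommRingCat.ofHom (algebraMap A B)) ≫ g = f := by
  have hff : (algebraMap A B).FaithfullyFlat :=
    RingHom.faithfullyFlat_algebraMap_iff.mpr inferInstance
  have hflat : Flat (Spec.map (CommRingCat.ofHom (algebraMap A B))) := by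
    rw [Flat.SpecMap_iff]
    exact hff.flat
  have hsurj : Surjective (Spec.map (CommRingCat.ofHom (algebraMap A B))) :=
    ⟨(RingHom.FaithfullyFlat.iff_flat_and_comap_surjective.mp hff).2⟩
  have := isRegularEpi_of_flat_of_surjective_of_isAffine
    (Spec.map (CommRingCat.ofHom (algebraMap A B)))
  refine IsRegularEpi.exists_of_isKernelPair _
    (isPullback_SpecMap_of_isPushout _ _ _ _ (CommRingCat.isPushout_tensorProduct A B B)) f ?_
  -- A geometric point of `Spec (B ⊗[A] B)` is a pair of geometric points of `Spec B` over the same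
  -- point of `Spec A`, which is the situation of `H`.
  apply spec_hom_ext_of_isAlgClosed
  intro K _ _ χ
  rw [← Category.assoc, ← Category.assoc, ← Spec.map_comp, ← Spec.map_comp,
    ← CommRingCat.ofHom_comp, ← CommRingCat.ofHom_comp]
  apply H
  ext a
  simp only [RingHom.comp_apply, AlgHom.toRingHom_eq_coe, RingHom.coe_coe, AlgHom.commutes]
  rfl

/-- A morphism from the spectrum of a local domain which is constant at the generic point is
constant. -/
lemma specialize_eq_of_generic_eq {O K : Type u} [CommRing O] [IsDomain O] [IsLocalRing O]
    [Field K] (i : K →+* O) (L : Type u) [Field L] (j : O →+* L) (hj : Function.Injective j)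
    {Y : Scheme.{u}} (f : Spec (CommRingCat.of O) ⟶ Y) (y : Spec (CommRingCat.of K) ⟶ Y)
    (H : Spec.map (CommRingCat.ofHom j) ≫ f = Spec.map (CommRingCat.ofHom (j.comp i)) ≫ y) :
    f = Spec.map (CommRingCat.ofHom i) ≫ y := by
  -- An open set containing the image of the closed point contains the image of all of `Spec O`,
  -- because every point of `Spec O` specializes to the closed one. This replaces `Y` by the affine,
  -- hence separated, scheme `V`.
  obtain ⟨_, ⟨(V : Y.Opens), hV, rfl⟩, hmem, -⟩ := Y.isBasis_affineOpens.exists_subset_of_mem_open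
    (Set.mem_univ (f (IsLocalRing.closedPoint O))) isOpen_univ
  replace hV : IsAffineOpen V := hV
  have hpre : f ⁻¹ᵁ V = ⊤ := Scheme.preimage_eq_top_of_closedPoint_mem f hmem
  have hf : ∀ x, f x ∈ V := fun x => by
    have : x ∈ f ⁻¹ᵁ V := by rw [hpre]; trivial
    exact this
  have hy : ∀ x, y x ∈ V := fun x => by
    let p : Spec (CommRingCat.of L) := IsLocalRing.closedPoint L
    have := congr($H p)
    rw [Scheme.Hom.comp_apply, Scheme.Hom.comp_apply] at this
    rw [Subsingleton.elim x (Spec.map (CommRingCat.ofHom (j.comp i)) p), ← this]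
    exact hf _
  let f' := IsOpenImmersion.lift V.ι f (by rintro _ ⟨x, rfl⟩; simpa using hf x)
  let y' := IsOpenImmersion.lift V.ι y (by rintro _ ⟨x, rfl⟩; simpa using hy x)
  have hf' : f' ≫ V.ι = f := IsOpenImmersion.lift_fac _ _ _
  have hy' : y' ≫ V.ι = y := IsOpenImmersion.lift_fac _ _ _
  have : IsAffine V := hV
  have hdom : IsDominant (Spec.map (CommRingCat.ofHom j)) := by
    constructor
    exact (PrimeSpectrum.denseRange_comap_iff_ker_le_nilRadical _).mpr (by
      rw [CommRingCat.hom_ofHom, (RingHom.injective_iff_ker_eq_bot j).mp hj]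
      exact bot_le)
  -- Two morphisms from a reduced scheme to a separated one agree if they agree on a dominant
  -- subobject; `Spec L → Spec O` is dominant because `j` is injective.
  have key : f' = Spec.map (CommRingCat.ofHom i) ≫ y' := by
    refine ext_of_isDominant_of_isSeparated (terminal.from V.toScheme) (Subsingleton.elim _ _)
      (Spec.map (CommRingCat.ofHom j)) ?_
    rw [← cancel_mono V.ι, Category.assoc, hf', Category.assoc, Category.assoc, hy', H,
      CommRingCat.ofHom_comp, Spec.map_comp, Category.assoc]
  rw [← hf', key, Category.assoc, hy']

end Schemes

/-! ### Points of schemes over `F`: extensionality, descent, specialization -/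

section SchemePoints

open AlgebraicGeometry

variable {F : Type u} [Field F] {Y : Over (Spec (CommRingCat.of F))}

/-- The morphism of schemes underlying a point of `Y`. -/
def toSpecHom {R : CommAlgCat.{u} F} (y : (schemePoints Y).obj R) :
    Spec (CommRingCat.of R) ⟶ Y.left :=
  CommaMorphism.left (show (algSpec (CommRingCat.of F)).obj (Opposite.op R) ⟶ Y from y)

lemma toSpecHom_injective {R : CommAlgCat.{u} F} {y y' : (schemePoints Y).obj R}
    (h : toSpecHom y = toSpecHom y') : y = y' :=
  Over.OverMorphism.ext h

lemma toSpecHom_map {R S : CommAlgCat.{u} F} (φ : R ⟶ S) (y : (schemePoints Y).obj R) :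
    toSpecHom ((schemePoints Y).map φ y) =
      Spec.map (CommRingCat.ofHom φ.hom.toRingHom) ≫ toSpecHom y := rfl

lemma toSpecHom_comp {R : CommAlgCat.{u} F} (y : (schemePoints Y).obj R) :
    toSpecHom y ≫ Y.hom = Spec.map (CommRingCat.ofHom (algebraMap F R)) :=
  Over.w (show (algSpec (CommRingCat.of F)).obj (Opposite.op R) ⟶ Y from y)

/-- A morphism of schemes over `F` as a point of `Y`. -/
def ofSpecHom {R : CommAlgCat.{u} F} (g : Spec (CommRingCat.of R) ⟶ Y.left)
    (h : g ≫ Y.hom = Spec.map (CommRingCat.ofHom (algebraMap F R))) :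
    (schemePoints Y).obj R :=
  (Over.homMk g h : (algSpec (CommRingCat.of F)).obj (Opposite.op R) ⟶ Y)

lemma toSpecHom_ofSpecHom {R : CommAlgCat.{u} F} (g : Spec (CommRingCat.of R) ⟶ Y.left)
    (h : g ≫ Y.hom = Spec.map (CommRingCat.ofHom (algebraMap F R))) :
    toSpecHom (ofSpecHom g h) = g := rfl

/-- Points of a scheme with values in a reduced algebra are determined by their images over
algebraically closed fields. -/
lemma points_ext {A : CommAlgCat.{u} F} [_root_.IsReduced A] {y y' : (schemePoints Y).obj A}
    (H : ∀ (K : Type u) [Field K] [IsAlgClosed K] [Algebra F K] (φ : A →ₐ[F] K),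
      (schemePoints Y).map (CommAlgCat.ofHom φ) y = (schemePoints Y).map (CommAlgCat.ofHom φ) y') :
    y = y' := by
  apply toSpecHom_injective
  apply spec_hom_ext_of_isAlgClosed
  intro K _ _ φ
  let : Algebra F K := (φ.comp (algebraMap F A)).toAlgebra
  exact congrArg toSpecHom (H K { φ with commutes' := fun _ => rfl })

/-- Descent of points of a scheme along a faithfully flat extension of algebras. -/
lemma exists_points_descent {A B : Type u} [CommRing A] [CommRing B] [Algebra F A] [Algebra F B]
    [Algebra A B] [IsScalarTower F A B] [Module.FaithfullyFlat A B] [_root_.IsReduced (B ⊗[A] B)]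
    (y : (schemePoints Y).obj (CommAlgCat.of F B))
    (H : ∀ (K : Type u) [Field K] [IsAlgClosed K] [Algebra F K] (φ ψ : B →ₐ[F] K),
      (∀ a : A, φ (algebraMap A B a) = ψ (algebraMap A B a)) →
      (schemePoints Y).map (CommAlgCat.ofHom φ) y = (schemePoints Y).map (CommAlgCat.ofHom ψ) y) :
    ∃ z : (schemePoints Y).obj (CommAlgCat.of F A),
      (schemePoints Y).map (CommAlgCat.ofHom (IsScalarTower.toAlgHom F A B)) z = y := by
  obtain ⟨g, hg⟩ := exists_spec_descent (A := A) (toSpecHom y) (fun K _ _ φ ψ h => by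
    let : Algebra F K := (φ.comp (algebraMap F B)).toAlgebra
    have hψ : ∀ r : F, ψ (algebraMap F B r) = algebraMap F K r := fun r => by
      rw [IsScalarTower.algebraMap_apply F A B, ← RingHom.comp_apply, ← h]
      rw [RingHom.comp_apply, ← IsScalarTower.algebraMap_apply F A B]
      rfl
    exact congrArg toSpecHom (H K { φ with commutes' := fun _ => rfl }
      { ψ with commutes' := hψ } (fun a => RingHom.congr_fun h a)))
  have hff : (algebraMap A B).FaithfullyFlat :=
    RingHom.faithfullyFlat_algebraMap_iff.mpr inferInstance
  have hflat : Flat (Spec.map (CommRingCat.ofHom (algebraMap A B))) := by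
    rw [Flat.SpecMap_iff]
    exact hff.flat
  have hsurj : Surjective (Spec.map (CommRingCat.ofHom (algebraMap A B))) :=
    ⟨(RingHom.FaithfullyFlat.iff_flat_and_comap_surjective.mp hff).2⟩
  -- Being an epimorphism allows the compatibility of `g` with the structure morphisms to `Spec F`
  -- to be checked after pullback to `Spec B`.
  have hepi : Epi (Spec.map (CommRingCat.ofHom (algebraMap A B))) :=
    Flat.epi_of_flat_of_surjective _
  refine ⟨ofSpecHom (R := CommAlgCat.of F A) g ?_, toSpecHom_injective ?_⟩
  · rw [← cancel_epi (Spec.map (CommRingCat.ofHom (algebraMap A B))), ← Category.assoc, hg,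
      toSpecHom_comp]
    change _ = Spec.map _ ≫ Spec.map (CommRingCat.ofHom (algebraMap F A))
    rw [← Spec.map_comp, ← CommRingCat.ofHom_comp, ← IsScalarTower.algebraMap_eq F A B]
  · rw [toSpecHom_map, toSpecHom_ofSpecHom, ← hg]
    rfl

/-- A point with values in a local domain which is constant generically is constant. -/
lemma points_specialize {O K L : Type u} [CommRing O] [IsDomain O] [IsLocalRing O] [Field K]
    [Field L] [Algebra F O] [Algebra F K] [Algebra F L] (i : K →ₐ[F] O) (j : O →ₐ[F] L)
    (hj : Function.Injective j) (e : O →ₐ[F] K) (he : e.comp i = AlgHom.id F K)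
    (y : (schemePoints Y).obj (CommAlgCat.of F O)) (z : (schemePoints Y).obj (CommAlgCat.of F K))
    (H : (schemePoints Y).map (CommAlgCat.ofHom j) y =
      (schemePoints Y).map (CommAlgCat.ofHom (j.comp i)) z) :
    (schemePoints Y).map (CommAlgCat.ofHom e) y = z := by
  have h := specialize_eq_of_generic_eq (i : K →+* O) L (j : O →+* L) hj (toSpecHom y)
    (toSpecHom z) (congrArg toSpecHom H)
  have h' : y = (schemePoints Y).map (CommAlgCat.ofHom i) z := toSpecHom_injective h
  rw [h', ← ConcreteCategory.comp_apply, ← Functor.map_comp, ← CommAlgCat.ofHom_comp, he]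
  exact ConcreteCategory.congr_hom ((schemePoints Y).map_id _) z

end SchemePoints

/-! ## Degenerations of pairs of matrices -/

section Triangular

open Module

variable {K : Type u} [Field K]

/-- Two maps in opposite directions between spaces of the same positive dimension preserve a pair
of lines. -/
lemma exists_stable_lines [IsAlgClosed K] {V₁ V₂ : Type u} [AddCommGroup V₁] [Module K V₁] [FiniteDimensional K V₁]
    [AddCommGroup V₂] [Module K V₂] [FiniteDimensional K V₂] [Nontrivial V₁]
    (h : finrank K V₁ = finrank K V₂) (A : V₂ →ₗ[K] V₁) (B : V₁ →ₗ[K] V₂) :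
    ∃ v : V₁, ∃ w : V₂, v ≠ 0 ∧ w ≠ 0 ∧ (∃ a : K, A w = a • v) ∧ ∃ b : K, B v = b • w := by
  -- For injective `B`, an eigenvector `v` of `A ∘ B` and `w = B v` work. Otherwise `v` is taken in
  -- the kernel of `B`, and `w` is a preimage of `v` under `A` or a vector of the kernel of `A`;
  -- equality of dimensions guarantees that one of the two exists.
  by_cases hB : Function.Injective B
  · obtain ⟨μ, hμ⟩ := Module.End.exists_eigenvalue (A ∘ₗ B)
    obtain ⟨v, hv⟩ := hμ.exists_hasEigenvector
    refine ⟨v, B v, hv.2, fun h0 => hv.2 (hB (by rw [h0, map_zero])), ⟨μ, hv.apply_eq_smul⟩,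
      ⟨1, (one_smul _ _).symm⟩⟩
  · obtain ⟨v, hv, hv0⟩ : ∃ v, B v = 0 ∧ v ≠ 0 := by
      rw [← LinearMap.ker_eq_bot, Submodule.eq_bot_iff] at hB
      push Not at hB
      exact hB
    have hBv : ∃ b : K, B v = 0 := ⟨0, hv⟩
    by_cases hA : Function.Injective A
    · obtain ⟨w, hw⟩ := (LinearMap.injective_iff_surjective_of_finrank_eq_finrank h.symm).mp hA v
      refine ⟨v, w, hv0, ?_, ⟨1, by rw [hw, one_smul]⟩, ⟨0, by rw [hv, zero_smul]⟩⟩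
      rintro rfl
      exact hv0 (by rw [← hw, map_zero])
    · obtain ⟨w, hw, hw0⟩ : ∃ w, A w = 0 ∧ w ≠ 0 := by
        rw [← LinearMap.ker_eq_bot, Submodule.eq_bot_iff] at hA
        push Not at hA
        exact hA
      exact ⟨v, w, hv0, hw0, ⟨0, by rw [hw, zero_smul]⟩, ⟨0, by rw [hv, zero_smul]⟩⟩

/-- A basis of a vector space obtained from a basis of the kernel of a nonzero functional. -/
lemma exists_basis_cons {V : Type u} [AddCommGroup V] [Module K V] {n : ℕ} {φ : Dual K V}
    (hφ : φ ≠ 0) (b : Basis (Fin n) K (LinearMap.ker φ)) :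
    ∃ b' : Basis (Fin (n + 1)) K V, ∀ i, b' i.succ = b i := by
  obtain ⟨y, hy⟩ : ∃ y, φ y ≠ 0 := by
    by_contra! h
    exact hφ (LinearMap.ext h)
  refine ⟨Basis.mkFinCons y b ?_ ?_, fun i => by rw [Basis.coe_mkFinCons]; rfl⟩
  · intro c x hx h
    have := congrArg φ h
    rw [map_add, LinearMap.mem_ker.mp hx, map_smul, add_zero, map_zero, smul_eq_mul] at this
    exact (mul_eq_zero.mp this).resolve_right hy
  · intro z
    refine ⟨-(φ z / φ y), ?_⟩
    rw [LinearMap.mem_ker, map_add, map_smul, smul_eq_mul]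
    field_simp
    ring

lemma repr_cons_of_mem_ker {V : Type u} [AddCommGroup V] [Module K V] {n : ℕ} {φ : Dual K V}
    (b : Basis (Fin n) K (LinearMap.ker φ)) (b' : Basis (Fin (n + 1)) K V)
    (hb : ∀ i, b' i.succ = b i) (x : LinearMap.ker φ) :
    b'.repr x 0 = 0 ∧ ∀ i, b'.repr x i.succ = b.repr x i := by
  have hx : (x : V) = ∑ i, (Fin.cons 0 (b.repr x) : Fin (n + 1) → K) i • b' i := by
    rw [Fin.sum_univ_succ]
    simp only [Fin.cons_zero, zero_smul, Fin.cons_succ, zero_add, hb]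
    have := congrArg (LinearMap.ker φ).subtype (b.sum_repr x)
    rw [map_sum] at this
    exact this.symm
  have hr : ∀ i, b'.repr x i = (Fin.cons 0 (b.repr x) : Fin (n + 1) → K) i := fun i => by
    rw [hx, Basis.repr_sum_self]
  exact ⟨by rw [hr, Fin.cons_zero], fun i => by rw [hr, Fin.cons_succ]⟩

/-- Two maps in opposite directions between spaces of the same dimension are simultaneously
triangular in suitable bases. -/
lemma exists_bases_triangular [IsAlgClosed K] (n : ℕ) : ∀ {V₁ V₂ : Type u} [AddCommGroup V₁] [Module K V₁]
    [FiniteDimensional K V₁] [AddCommGroup V₂] [Module K V₂] [FiniteDimensional K V₂]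
    (_ : finrank K V₁ = n) (_ : finrank K V₂ = n) (A : V₂ →ₗ[K] V₁) (B : V₁ →ₗ[K] V₂),
    ∃ (b₁ : Basis (Fin n) K V₁) (b₂ : Basis (Fin n) K V₂), ∀ i j, i < j →
      b₁.repr (A (b₂ j)) i = 0 ∧ b₂.repr (B (b₁ j)) i = 0 := by
  induction n with
  | zero =>
    intro V₁ V₂ _ _ _ _ _ _ h₁ h₂ A B
    exact ⟨finBasisOfFinrankEq K V₁ h₁, finBasisOfFinrankEq K V₂ h₂, fun i => i.elim0⟩
  | succ n ih =>
    intro V₁ V₂ _ _ _ _ _ _ h₁ h₂ A B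
    have : Nontrivial (Dual K V₁) := by
      apply nontrivial_of_finrank_pos (R := K)
      rw [Subspace.dual_finrank_eq, h₁]
      exact Nat.succ_pos n
    -- Stable lines for the transposed maps are stable hyperplanes for `A` and `B`. The induction
    -- runs on these kernels, and the added basis vectors come first, so the matrices are lower
    -- triangular.
    obtain ⟨φ₁, φ₂, hφ₁, hφ₂, ⟨b, hb⟩, ⟨a, ha⟩⟩ := exists_stable_lines
      (by rw [Subspace.dual_finrank_eq, Subspace.dual_finrank_eq, h₁, h₂]) B.dualMap A.dualMap
    have hA : ∀ x ∈ LinearMap.ker φ₂, A x ∈ LinearMap.ker φ₁ := fun x hx => by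
      have := LinearMap.congr_fun ha x
      rwa [LinearMap.dualMap_apply, LinearMap.smul_apply, LinearMap.mem_ker.mp hx,
        smul_zero] at this
    have hB : ∀ x ∈ LinearMap.ker φ₁, B x ∈ LinearMap.ker φ₂ := fun x hx => by
      have := LinearMap.congr_fun hb x
      rwa [LinearMap.dualMap_apply, LinearMap.smul_apply, LinearMap.mem_ker.mp hx,
        smul_zero] at this
    have hk : ∀ {V : Type u} [AddCommGroup V] [Module K V] [FiniteDimensional K V] {φ : Dual K V}
        (_ : φ ≠ 0) (_ : finrank K V = n + 1), finrank K (LinearMap.ker φ) = n :=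
      fun hφ h => by
        have := Module.Dual.finrank_ker_add_one_of_ne_zero hφ
        omega
    obtain ⟨b₁, b₂, hb'⟩ := ih (hk hφ₁ h₁) (hk hφ₂ h₂) (A.restrict hA) (B.restrict hB)
    obtain ⟨b₁', hb₁⟩ := exists_basis_cons hφ₁ b₁
    obtain ⟨b₂', hb₂⟩ := exists_basis_cons hφ₂ b₂
    refine ⟨b₁', b₂', fun i j hij => ?_⟩
    obtain ⟨j, rfl⟩ := Fin.exists_succ_eq.mpr (Fin.ne_zero_of_lt hij)
    have eA := repr_cons_of_mem_ker b₁ b₁' hb₁ (A.restrict hA (b₂ j))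
    have eB := repr_cons_of_mem_ker b₂ b₂' hb₂ (B.restrict hB (b₁ j))
    rw [hb₁, hb₂]
    induction i using Fin.cases with
    | zero => exact ⟨eA.1, eB.1⟩
    | succ i =>
      have := hb' i j (Fin.succ_lt_succ_iff.mp hij)
      exact ⟨(eA.2 i).trans this.1, (eB.2 i).trans this.2⟩

/-- `P` and `Q` are change-of-basis matrices, and the relations avoid their inverses in order to
have the shape used over `K⟦X⟧`, where `P` and `Q` are only generically invertible. -/
lemma exists_triangular [IsAlgClosed K] {n : ℕ} (A B : Matrix (Fin n) (Fin n) K) :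
    ∃ P Q A' B' : Matrix (Fin n) (Fin n) K, P.det ≠ 0 ∧ Q.det ≠ 0 ∧ A' * Q = P * A ∧
      B' * P = Q * B ∧ ∀ i j, i < j → A' i j = 0 ∧ B' i j = 0 := by
  have hd : finrank K (Fin n → K) = n := by simp
  let e := Pi.basisFun K (Fin n)
  obtain ⟨b₁, b₂, h⟩ := exists_bases_triangular n hd hd (Matrix.toLin e e A) (Matrix.toLin e e B)
  have hdet : ∀ b : Basis (Fin n) K (Fin n → K), (b.toMatrix e).det ≠ 0 := fun b => by
    rw [← Basis.det_apply]
    exact (Basis.isUnit_det b e).ne_zero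
  refine ⟨b₁.toMatrix e, b₂.toMatrix e, LinearMap.toMatrix b₂ b₁ (Matrix.toLin e e A),
    LinearMap.toMatrix b₁ b₂ (Matrix.toLin e e B), hdet b₁, hdet b₂, ?_, ?_, fun i j hij => ?_⟩
  · conv_rhs => rw [← LinearMap.toMatrix_toLin e e A]
    rw [linearMap_toMatrix_mul_basis_toMatrix, basis_toMatrix_mul_linearMap_toMatrix]
  · conv_rhs => rw [← LinearMap.toMatrix_toLin e e B]
    rw [linearMap_toMatrix_mul_basis_toMatrix, basis_toMatrix_mul_linearMap_toMatrix]
  · rw [LinearMap.toMatrix_apply, LinearMap.toMatrix_apply]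
    exact h i j hij

end Triangular

/-! ### Families over `K⟦X⟧` and their special fibres -/

section Degeneration

variable {K : Type u} [Field K] {n : ℕ}

open PowerSeries

/-- A function of pairs of matrices is invariant under degeneration if it takes the same value at
`(A, B)` and at the special fibre of each family over `K⟦X⟧` which is generically equivalent to
`(A, B)`. -/
def IsDegenerationInvariant {T : Type*}
    (r : Matrix (Fin n) (Fin n) K → Matrix (Fin n) (Fin n) K → T) : Prop :=
  ∀ (A B : Matrix (Fin n) (Fin n) K) (A' B' P Q : Matrix (Fin n) (Fin n) K⟦X⟧),
    P.det ≠ 0 → Q.det ≠ 0 → A' * Q = P * A.map (C (R := K)) → B' * P = Q * B.map (C (R := K)) →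
      r (A'.map (constantCoeff (R := K))) (B'.map (constantCoeff (R := K))) = r A B

/-- `A' B'` is conjugate to the constant matrix `A B` over the fraction field of `K⟦X⟧`, so its
characteristic polynomial is constant and survives reduction. This keeps track of the eigenvalues
along the same degenerations that are applied to a general `r`. -/
lemma isDegenerationInvariant_charpoly :
    IsDegenerationInvariant fun A B : Matrix (Fin n) (Fin n) K => (A * B).charpoly := by
  intro A B A' B' P Q hP hQ hA hB
  have h : (A' * B') * P = P * (A * B).map (C (R := K)) := by
    rw [mul_assoc, hB, ← mul_assoc, hA, mul_assoc, Matrix.map_mul]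
  have hc : (A' * B').charpoly = ((A * B).map (C (R := K))).charpoly := by
    have hd : (P.map (Polynomial.C (R := K⟦X⟧))).det ≠ 0 := by
      rw [← RingHom.mapMatrix_apply, ← RingHom.map_det]
      exact Polynomial.C_ne_zero.mpr hP
    apply mul_right_cancel₀ hd
    rw [Matrix.charpoly, Matrix.charpoly, ← Matrix.det_mul, mul_comm (Matrix.det _),
      ← Matrix.det_mul]
    congr 1
    have h' := congrArg (fun N => N.map (Polynomial.C (R := K⟦X⟧))) h
    simp only [Matrix.map_mul] at h'
    rw [Matrix.charmatrix, Matrix.charmatrix, sub_mul, mul_sub, RingHom.mapMatrix_apply,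
      RingHom.mapMatrix_apply, Matrix.map_mul, Matrix.map_mul, Matrix.map_mul, h']
    congr 1
    exact Matrix.scalar_commute _ (Commute.all _) _
  change (A'.map (constantCoeff (R := K)) * B'.map (constantCoeff (R := K))).charpoly = _
  rw [← Matrix.map_mul, Matrix.charpoly_map, hc, ← Matrix.charpoly_map]
  congr 1

variable {T : Type*} {r : Matrix (Fin n) (Fin n) K → Matrix (Fin n) (Fin n) K → T}

/-- Equivalence over `K` is the case of a constant family. -/
lemma IsDegenerationInvariant.conj (hr : IsDegenerationInvariant r)
    {A B A' B' P Q : Matrix (Fin n) (Fin n) K} (hP : P.det ≠ 0) (hQ : Q.det ≠ 0)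
    (hA : A' * Q = P * A) (hB : B' * P = Q * B) : r A' B' = r A B := by
  have hd : ∀ {N : Matrix (Fin n) (Fin n) K}, N.det ≠ 0 → (N.map (C (R := K))).det ≠ 0 := by
    intro N hN
    rw [← RingHom.mapMatrix_apply, ← RingHom.map_det]
    exact (map_ne_zero_iff _ C_injective).mpr hN
  have hs : ∀ N : Matrix (Fin n) (Fin n) K,
      (N.map (C (R := K))).map (constantCoeff (R := K)) = N := fun N => by ext i j; simp
  have := hr A B (A'.map (C (R := K))) (B'.map (C (R := K))) (P.map (C (R := K)))
    (Q.map (C (R := K))) (hd hP) (hd hQ) (by rw [← Matrix.map_mul, hA, Matrix.map_mul])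
    (by rw [← Matrix.map_mul, hB, Matrix.map_mul])
  rwa [hs, hs] at this

lemma IsDegenerationInvariant.diagonal (hr : IsDegenerationInvariant r)
    {a b : Fin n → K} {a' b' p q : Fin n → K⟦X⟧} (hp : ∀ i, p i ≠ 0) (hq : ∀ i, q i ≠ 0)
    (ha : ∀ i, a' i * q i = p i * C (a i)) (hb : ∀ i, b' i * p i = q i * C (b i)) :
    r (Matrix.diagonal fun i => constantCoeff (a' i))
      (Matrix.diagonal fun i => constantCoeff (b' i)) =
      r (Matrix.diagonal a) (Matrix.diagonal b) := by
  have := hr (Matrix.diagonal a) (Matrix.diagonal b) (Matrix.diagonal a') (Matrix.diagonal b')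
    (Matrix.diagonal p) (Matrix.diagonal q)
    (by rw [Matrix.det_diagonal]; exact Finset.prod_ne_zero_iff.mpr fun i _ => hp i)
    (by rw [Matrix.det_diagonal]; exact Finset.prod_ne_zero_iff.mpr fun i _ => hq i)
    (by
      rw [Matrix.diagonal_map (map_zero _), Matrix.diagonal_mul_diagonal,
        Matrix.diagonal_mul_diagonal]
      exact congrArg _ (funext ha))
    (by
      rw [Matrix.diagonal_map (map_zero _), Matrix.diagonal_mul_diagonal,
        Matrix.diagonal_mul_diagonal]
      exact congrArg _ (funext hb))
  rwa [Matrix.diagonal_map (map_zero _), Matrix.diagonal_map (map_zero _)] at this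

lemma IsDegenerationInvariant.triangular (hr : IsDegenerationInvariant r)
    {A B : Matrix (Fin n) (Fin n) K} (h : ∀ i j, i < j → A i j = 0 ∧ B i j = 0) :
    r (Matrix.diagonal fun i => A i i) (Matrix.diagonal fun i => B i i) = r A B := by
  -- Conjugation by `diag(X^i)` multiplies the entry `(i, j)` by `X^(i-j)`. For lower triangular
  -- matrices the result is integral, and at `X = 0` only the diagonal remains. The truncated
  -- subtraction in `f` is used only for `j ≤ i`.
  let t : Fin n → K⟦X⟧ := fun i => X ^ (i : ℕ)
  let f : Matrix (Fin n) (Fin n) K → Matrix (Fin n) (Fin n) K⟦X⟧ := fun N =>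
    Matrix.of fun i j => if j ≤ i then C (N i j) * X ^ ((i : ℕ) - j) else 0
  have hd : (Matrix.diagonal t).det ≠ 0 := by
    rw [Matrix.det_diagonal]
    exact Finset.prod_ne_zero_iff.mpr fun i _ => pow_ne_zero _ X_ne_zero
  have hf : ∀ N : Matrix (Fin n) (Fin n) K, (∀ i j, i < j → N i j = 0) →
      f N * Matrix.diagonal t = Matrix.diagonal t * N.map (C (R := K)) := by
    intro N hN
    ext1 i j
    rw [Matrix.mul_diagonal, Matrix.diagonal_mul, Matrix.map_apply]
    by_cases hij : j ≤ i
    · simp only [f, t, Matrix.of_apply, if_pos hij]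
      rw [mul_assoc, ← pow_add, Nat.sub_add_cancel hij, mul_comm]
    · simp only [f, t, Matrix.of_apply, if_neg hij]
      rw [hN i j (not_le.mp hij), map_zero, zero_mul, mul_zero]
  have hs : ∀ N : Matrix (Fin n) (Fin n) K,
      (f N).map (constantCoeff (R := K)) = Matrix.diagonal fun i => N i i := by
    intro N
    ext i j
    rw [Matrix.map_apply, Matrix.diagonal_apply]
    rcases lt_trichotomy i j with hij | rfl | hij
    · simp [f, hij.ne, not_le.mpr hij]
    · simp [f]
    · have : (i : ℕ) - j ≠ 0 := Nat.sub_ne_zero_of_lt hij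
      simp [f, hij.ne', hij.le, this]
  have := hr A B (f A) (f B) (Matrix.diagonal t) (Matrix.diagonal t) hd hd
    (hf A fun i j hij => (h i j hij).1) (hf B fun i j hij => (h i j hij).2)
  rwa [hs, hs] at this

/-- Where `b i ≠ 0`, rescaling by `b i` turns `(a i, b i)` into `(a i * b i, 1)`. Where `b i = 0`,
the pairs `(a i, 0)` and `(0, 1)` are not equivalent, but both degenerate to `(0, 0)`. Hence the two
families `h₁` and `h₂` with the same special fibre. -/
lemma IsDegenerationInvariant.diagonal_one (hr : IsDegenerationInvariant r) (a b : Fin n → K) :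
    r (Matrix.diagonal fun i => a i * b i) 1 = r (Matrix.diagonal a) (Matrix.diagonal b) := by
  classical
  have h₁ := hr.diagonal (a := a) (b := b)
    (a' := fun i => if b i = 0 then X * C (a i) else C (a i * b i))
    (b' := fun i => if b i = 0 then 0 else 1)
    (p := fun i => if b i = 0 then X else C (b i)) (q := fun _ => 1)
    (fun i => by split_ifs with h; exacts [X_ne_zero, (map_ne_zero_iff _ C_injective).mpr h])
    (fun _ => one_ne_zero)
    (fun i => by split_ifs with h <;> simp [mul_comm])
    (fun i => by split_ifs with h <;> simp [h])
  have h₂ := hr.diagonal (a := fun i => a i * b i) (b := fun _ => 1)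
    (a' := fun i => C (a i * b i))
    (b' := fun i => if b i = 0 then X else 1)
    (p := fun _ => 1) (q := fun i => if b i = 0 then X else 1)
    (fun _ => one_ne_zero)
    (fun i => by split_ifs; exacts [X_ne_zero, one_ne_zero])
    (fun i => by split_ifs with h <;> simp [h])
    (fun i => by split_ifs with h <;> simp)
  rw [← Matrix.diagonal_one, ← h₂, ← h₁]
  congr 2
  · ext i
    split_ifs with h <;> simp [h]
  · ext i
    split_ifs with h <;> simp

lemma exists_perm_of_map_univ_eq {α β : Type*} [Fintype α] {f g : α → β}
    (h : Finset.univ.val.map f = Finset.univ.val.map g) : ∃ σ : Equiv.Perm α, g ∘ σ = f := by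
  classical
  have e : ∀ c, Nonempty ({a // f a = c} ≃ {a // g a = c}) := fun c => by
    apply Fintype.card_eq.mp
    have := congrArg (Multiset.count c) h
    rw [Multiset.count_map, Multiset.count_map] at this
    rw [Fintype.card_subtype, Fintype.card_subtype]
    simpa only [eq_comm, Finset.card, Finset.filter_val] using this
  exact ⟨Equiv.ofFiberEquiv fun c => (e c).some, funext fun a => Equiv.ofFiberEquiv_map _ a⟩

lemma IsDegenerationInvariant.perm (hr : IsDegenerationInvariant r) (σ : Equiv.Perm (Fin n))
    (a : Fin n → K) : r (Matrix.diagonal (a ∘ σ)) 1 = r (Matrix.diagonal a) 1 := by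
  have hd : (σ.permMatrix K).det ≠ 0 := by
    rw [Matrix.det_permutation]
    rcases Int.units_eq_one_or (Equiv.Perm.sign σ) with h | h <;> simp [h]
  refine hr.conj hd hd ?_ (by rw [one_mul, mul_one])
  ext i j
  rw [Matrix.diagonal_mul, Matrix.mul_diagonal]
  simp only [Equiv.Perm.permMatrix, PEquiv.toMatrix_apply, Equiv.toPEquiv_apply, Option.mem_def,
    Option.some.injEq, Function.comp_apply]
  split_ifs with h
  · rw [h, mul_comm]
  · simp

/-- Functions invariant under degeneration only depend on the characteristic polynomial. -/
theorem IsDegenerationInvariant.eq_of_charpoly_eq [IsAlgClosed K]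
    (hr : IsDegenerationInvariant r) {A B A' B' : Matrix (Fin n) (Fin n) K}
    (h : (A * B).charpoly = (A' * B').charpoly) : r A B = r A' B' := by
  have key : ∀ A B : Matrix (Fin n) (Fin n) K, ∃ l : Fin n → K, r (Matrix.diagonal l) 1 = r A B ∧
      (Finset.univ.val.map l) = (A * B).charpoly.roots := by
    intro A B
    obtain ⟨P, Q, A', B', hP, hQ, hA, hB, ht⟩ := exists_triangular A B
    refine ⟨fun i => A' i i * B' i i, ?_, ?_⟩
    · rw [hr.diagonal_one, hr.triangular ht, hr.conj hP hQ hA hB]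
    -- The chain of degenerations just used for `r` is applied to the function `(A * B).charpoly`
    -- itself, which identifies `l` with the eigenvalues of `A * B`.
    · have hc := isDegenerationInvariant_charpoly (n := n) (K := K)
      rw [← hc.conj hP hQ hA hB, ← hc.triangular ht, ← hc.diagonal_one, mul_one,
        Matrix.charpoly_diagonal]
      exact (Polynomial.roots_multiset_prod_X_sub_C _).symm.trans (by
        rw [Multiset.map_map]; rfl)
  obtain ⟨l, hl, hc⟩ := key A B
  obtain ⟨l', hl', hc'⟩ := key A' B'
  obtain ⟨σ, rfl⟩ := exists_perm_of_map_univ_eq (hc.trans (by rw [h, hc']))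
  rw [← hl, ← hl', hr.perm]

end Degeneration

/-! ## Quadratic extensions -/

section Quadratic

variable {F E : Type u} [Field F] [Field E] [Algebra F E] [Algebra.IsQuadraticExtension F E]
  {c : E ≃ₐ[F] E}

/-- The degree is prime, so `F(e)` is `F` or `E`; in the second case `c` would fix all of `E`. -/
lemma mem_range_of_fixed (hc : c ≠ AlgEquiv.refl) {e : E} (he : c e = e) :
    ∃ r : F, algebraMap F E r = e := by
  have hp : (Module.finrank F E).Prime := by
    rw [Algebra.IsQuadraticExtension.finrank_eq_two F E]
    exact Nat.prime_two
  have := IntermediateField.isSimpleOrder_of_finrank_prime F E hp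
  rcases eq_bot_or_eq_top (IntermediateField.adjoin F {e}) with h | h
  · rw [IntermediateField.adjoin_simple_eq_bot_iff] at h
    exact IntermediateField.mem_bot.mp h
  · refine absurd (AlgEquiv.ext fun x => ?_) hc
    have hx : x ∈ IntermediateField.adjoin F {e} := by rw [h]; trivial
    induction hx using IntermediateField.adjoin_induction with
    | mem y hy => rw [Set.mem_singleton_iff.mp hy]; exact he
    | algebraMap r => exact c.commutes r
    | add y z _ _ hy hz => rw [map_add, hy, hz]; rfl
    | inv y _ hy => rw [map_inv₀, hy]; rfl
    | mul y z _ _ hy hz => rw [map_mul, hy, hz]; rfl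

lemma conj_involutive (c : E ≃ₐ[F] E) (e : E) : c (c e) = e := by
  have h1 : Nat.card (E ≃ₐ[F] E) ≤ 2 := by
    rw [Nat.card_eq_fintype_card, ← Algebra.IsQuadraticExtension.finrank_eq_two F E]
    exact AlgEquiv.card_le
  have h2 : orderOf c ≤ 2 := (Nat.le_of_dvd Nat.card_pos (orderOf_dvd_natCard c)).trans h1
  have h3 : 0 < orderOf c := orderOf_pos c
  have h4 : c ^ 2 = 1 := by
    interval_cases h : orderOf c
    · rw [orderOf_eq_one_iff.mp h, one_pow]
    · rw [← h, pow_orderOf_eq_one]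
  have := congrArg (fun f : E ≃ₐ[F] E => f e) h4
  simpa [pow_two] using this

lemma exists_anti (hc : c ≠ AlgEquiv.refl) : ∃ δ : E, δ ≠ 0 ∧ c δ = -δ := by
  obtain ⟨e, he⟩ : ∃ e, c e ≠ e := by
    by_contra! h
    exact hc (AlgEquiv.ext h)
  exact ⟨e - c e, fun h => he (sub_eq_zero.mp h).symm, by rw [map_sub, conj_involutive, neg_sub]⟩

lemma exists_trace (hc : c ≠ AlgEquiv.refl) (e : E) : ∃ r : F, algebraMap F E r = e + c e :=
  mem_range_of_fixed hc (by rw [map_add, conj_involutive, add_comm])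

variable {R S : Type u} [CommRing R] [Algebra F R] [CommRing S] [Algebra F S]

lemma conj_conj (c : E ≃ₐ[F] E) (a : E ⊗[F] R) : conj R c (conj R c a) = a := by
  induction a using TensorProduct.induction_on with
  | zero => simp
  | add x y hx hy => rw [map_add, map_add, hx, hy]
  | tmul e r => rw [conj_tmul, conj_tmul, conj_involutive]

/-- Traces `a + conj a` lie in `1 ⊗ R`, and a fixed element is the trace of its half. This brings
the coefficients of the characteristic polynomial from `E ⊗ R` down to `R`. -/
lemma exists_tmul_of_conj_eq (hF : (2 : F) ≠ 0) (hc : c ≠ AlgEquiv.refl) {a : E ⊗[F] R}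
    (ha : conj R c a = a) : ∃ r : R, (1 : E) ⊗ₜ[F] r = a := by
  have h : ∀ a : E ⊗[F] R, ∃ r : R, (1 : E) ⊗ₜ[F] r = a + conj R c a := by
    intro a
    induction a using TensorProduct.induction_on with
    | zero => exact ⟨0, by simp⟩
    | add x y hx hy =>
      obtain ⟨r, hr⟩ := hx
      obtain ⟨s, hs⟩ := hy
      exact ⟨r + s, by rw [TensorProduct.tmul_add, hr, hs, map_add]; abel⟩
    | tmul e r =>
      obtain ⟨t, ht⟩ := exists_trace hc e
      refine ⟨t • r, ?_⟩
      rw [conj_tmul, ← TensorProduct.add_tmul, ← ht, TensorProduct.tmul_smul,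
        TensorProduct.smul_tmul', Algebra.smul_def, mul_one]
  obtain ⟨r, hr⟩ := h ((2 : F)⁻¹ • a)
  have hs : conj R c ((2 : F)⁻¹ • a) = (2 : F)⁻¹ • conj R c a :=
    map_smul (Algebra.TensorProduct.map (c : E →ₐ[F] E) (AlgHom.id F R)) _ _
  exact ⟨r, by rw [hr, hs, ha, ← two_smul F, smul_smul, mul_inv_cancel₀ hF, one_smul]⟩

omit [Algebra.IsQuadraticExtension F E] in
lemma one_tmul_injective : Function.Injective fun r : R => (1 : E) ⊗ₜ[F] r :=
  Algebra.TensorProduct.includeRight_injective (algebraMap F E).injective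

/-- The homomorphism `e ⊗ r ↦ ι(e) r`. -/
def contr (ι : E →ₐ[F] R) : E ⊗[F] R →ₐ[F] R :=
  Algebra.TensorProduct.lift ι (AlgHom.id F R) fun _ _ => Commute.all _ _

omit [Algebra.IsQuadraticExtension F E] in
@[simp] lemma contr_tmul (ι : E →ₐ[F] R) (e : E) (r : R) : contr ι (e ⊗ₜ r) = ι e * r := by
  simp [contr]

omit [Algebra.IsQuadraticExtension F E] in
lemma contr_pushScalar (ι : E →ₐ[F] R) (φ : R →ₐ[F] S) (a : E ⊗[F] R) :
    contr (φ.comp ι) (pushScalar E φ a) = φ (contr ι a) := by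
  induction a using TensorProduct.induction_on with
  | zero => simp
  | add x y hx hy => simp only [map_add, hx, hy]
  | tmul e r => simp

/-- `ε` is the idempotent of the factor of `E ⊗ R` on which `E` acts through `ι`; its conjugate cuts
out the complementary factor. -/
lemma exists_idempotent (hF : (2 : F) ≠ 0) (hc : c ≠ AlgEquiv.refl) (ι : E →ₐ[F] R) :
    ∃ ε : E ⊗[F] R, ε + conj R c ε = 1 ∧ contr ι (conj R c ε) = 0 ∧
      ∀ a, a * ε = ((1 : E) ⊗ₜ contr ι a) * ε := by
  obtain ⟨δ, hδ, hcδ⟩ := exists_anti hc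
  have hs : ∀ a : E ⊗[F] R, conj R c ((2 : F)⁻¹ • a) = (2 : F)⁻¹ • conj R c a :=
    map_smul (Algebra.TensorProduct.map (c : E →ₐ[F] E) (AlgHom.id F R)) _
  -- As `δ ^ 2` lies in `F`, the element `δ ⊗ δ⁻¹` has square `1`; `ε` projects onto its eigenvalue
  -- `1`, where `δ ⊗ 1` and `1 ⊗ δ` act alike. As `E = F + F δ`, the last property reduces to this.
  refine ⟨(2 : F)⁻¹ • (1 ⊗ₜ 1 + δ ⊗ₜ ι δ⁻¹), ?_, ?_, ?_⟩
  · rw [hs, map_add, conj_tmul, conj_tmul, hcδ, map_one, TensorProduct.neg_tmul, ← smul_add,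
      add_add_add_comm, add_neg_cancel, add_zero, ← two_smul F, smul_smul, inv_mul_cancel₀ hF,
      one_smul]
    rfl
  · rw [hs, map_add, conj_tmul, conj_tmul, hcδ, map_smul, map_add, contr_tmul, contr_tmul,
      ← map_mul, neg_mul, mul_inv_cancel₀ hδ]
    simp
  · intro a
    induction a using TensorProduct.induction_on with
    | zero => simp
    | add x y hx hy => rw [add_mul, hx, hy, map_add, TensorProduct.tmul_add, add_mul]
    | tmul e r =>
      obtain ⟨x, hx⟩ := exists_trace hc e
      obtain ⟨y, hy⟩ := mem_range_of_fixed hc (e := (e - c e) * δ⁻¹) (by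
        rw [map_mul, map_sub, conj_involutive, map_inv₀, hcδ, inv_neg]; ring)
      obtain ⟨s, hs⟩ := mem_range_of_fixed hc (e := δ * δ) (by rw [map_mul, hcδ]; ring)
      have hδδ : (δ * δ) ⊗ₜ[F] ι δ⁻¹ = (1 : E) ⊗ₜ[F] ι δ := by
        rw [← hs, Algebra.algebraMap_eq_smul_one, TensorProduct.smul_tmul, ← map_smul,
          Algebra.smul_def, hs, mul_assoc, mul_inv_cancel₀ hδ, mul_one]
      have hδe : δ ⊗ₜ[F] (1 : R) * (1 ⊗ₜ 1 + δ ⊗ₜ ι δ⁻¹) =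
          (1 : E) ⊗ₜ[F] ι δ * (1 ⊗ₜ 1 + δ ⊗ₜ ι δ⁻¹) := by
        rw [mul_add, mul_add, Algebra.TensorProduct.tmul_mul_tmul,
          Algebra.TensorProduct.tmul_mul_tmul, Algebra.TensorProduct.tmul_mul_tmul,
          Algebra.TensorProduct.tmul_mul_tmul, one_mul, one_mul, hδδ, ← map_mul,
          mul_inv_cancel₀ hδ, map_one, mul_one, mul_one, mul_one, one_mul, add_comm]
      have he : e = (2 : F)⁻¹ • (x • (1 : E) + y • δ) := by
        have h2' : (algebraMap F E 2) ≠ 0 := (map_ne_zero _).mpr hF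
        rw [Algebra.smul_def, Algebra.smul_def, Algebra.smul_def, hx, hy, mul_one, mul_assoc,
          inv_mul_cancel₀ hδ, map_inv₀, mul_one, eq_inv_mul_iff_mul_eq₀ h2', map_ofNat]
        ring
      have key : e ⊗ₜ[F] (1 : R) * (1 ⊗ₜ 1 + δ ⊗ₜ ι δ⁻¹) =
          (1 : E) ⊗ₜ[F] ι e * (1 ⊗ₜ 1 + δ ⊗ₜ ι δ⁻¹) := by
        rw [he, map_smul, map_add, map_smul, map_smul, map_one, TensorProduct.tmul_smul,
          TensorProduct.tmul_add, TensorProduct.tmul_smul, TensorProduct.tmul_smul,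
          ← TensorProduct.smul_tmul', TensorProduct.add_tmul, ← TensorProduct.smul_tmul',
          ← TensorProduct.smul_tmul', smul_mul_assoc, smul_mul_assoc, add_mul, add_mul,
          smul_mul_assoc, smul_mul_assoc, smul_mul_assoc, hδe]
      have hr : e ⊗ₜ[F] r = (1 ⊗ₜ r) * e ⊗ₜ 1 := by simp
      have hr' : (1 : E) ⊗ₜ[F] (ι e * r) = (1 ⊗ₜ r) * 1 ⊗ₜ ι e := by simp [mul_comm]
      rw [contr_tmul, hr, hr', mul_smul_comm, mul_smul_comm, mul_assoc, mul_assoc, key]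

/-- For an algebra `R` over `E`, the algebra `E ⊗ R` is `R × R`. -/
lemma contr_prod_bijective (hF : (2 : F) ≠ 0) (hc : c ≠ AlgEquiv.refl) (ι : E →ₐ[F] R) :
    Function.Bijective fun a : E ⊗[F] R => (contr ι a, contr ι (conj R c a)) := by
  obtain ⟨ε, h1, h0, hε⟩ := exists_idempotent hF hc ι
  have h1' : contr ι ε = 1 := by
    have := congrArg (contr ι) h1
    rwa [map_add, h0, add_zero, map_one] at this
  constructor
  · intro a b hab
    have hab1 : contr ι a = contr ι b := congrArg Prod.fst hab
    have hab2 : contr ι (conj R c a) = contr ι (conj R c b) := congrArg Prod.snd hab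
    have e1 : a * ε = b * ε := by rw [hε a, hε b, hab1]
    have e2 : a * conj R c ε = b * conj R c ε := by
      have : conj R c a * ε = conj R c b * ε := by rw [hε, hε (conj R c b), hab2]
      have := congrArg (conj R c) this
      rwa [map_mul, map_mul, conj_conj, conj_conj] at this
    rw [← mul_one a, ← mul_one b, ← h1, mul_add, mul_add, e1, e2]
  · rintro ⟨r, s⟩
    refine ⟨1 ⊗ₜ r * ε + 1 ⊗ₜ s * conj R c ε, ?_⟩
    simp [h1', h0, conj_conj]

/-- The scalar extension `E ⊗ R` of a reduced algebra `R` over `E` is reduced. -/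
lemma isReduced_tensor (hF : (2 : F) ≠ 0) (hc : c ≠ AlgEquiv.refl) (ι : E →ₐ[F] R)
    [IsReduced R] : IsReduced (E ⊗[F] R) :=
  isReduced_of_injective (((contr ι).toRingHom).prod ((contr ι).toRingHom.comp (conj R c)))
    (contr_prod_bijective hF hc ι).1

end Quadratic

/-! ## Forms in coordinates -/

section Coordinates

open Module

variable {F E : Type u} [Field F] [Field E] [Algebra F E] {c : E ≃ₐ[F] E}
variable {R S : Type u} [CommRing R] [Algebra F R] [CommRing S] [Algebra F S]
variable {V W : Type u} [AddCommGroup V] [Module E V] [AddCommGroup W] [Module E W]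
variable {d : ℕ}

/-- The Gram matrix of a sesquilinear form. -/
def gram (h : V →ₛₗ[(c : E →+* E)] V →ₗ[E] E) (b : Basis (Fin d) E V) :
    Matrix (Fin d) (Fin d) E :=
  Matrix.of fun i j => h (b i) (b j)

lemma isUnit_det_gram {h : V →ₛₗ[(c : E →+* E)] V →ₗ[E] E} (hn : h.Nondegenerate)
    (b : Basis (Fin d) E V) : IsUnit (gram h b).det := by
  rw [isUnit_iff_ne_zero]
  intro h0
  obtain ⟨v, hv0, hv⟩ := Matrix.exists_mulVec_eq_zero_iff.mpr h0
  apply hv0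
  have hz : ∑ j, v j • b j = 0 := by
    apply hn.2
    intro x
    have hx : h.flip (∑ j, v j • b j) = 0 := b.ext fun i => by
      have := congrFun hv i
      rw [LinearMap.flip_apply, map_sum, LinearMap.zero_apply]
      simpa [Matrix.mulVec, dotProduct, gram, mul_comm] using this
    exact LinearMap.congr_fun hx x
  exact funext fun i => Fintype.linearIndependent_iff.mp b.linearIndependent v hz i

lemma gram_transpose {h : V →ₛₗ[(c : E →+* E)] V →ₗ[E] E} (hh : h.IsSymm)
    (b : Basis (Fin d) E V) : (gram h b).transpose = (gram h b).map c := by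
  ext i j
  exact (hh.eq (b i) (b j)).symm

lemma conj_form {h : V →ₛₗ[(c : E →+* E)] V →ₗ[E] E} (hh : h.IsSymm)
    (hc : ∀ e, c (c e) = e) (u v : Pts F E R V) : conj R c (form R h u v) = form R h v u := by
  have hcc : ∀ a : E ⊗[F] R, conj R c (conj R c a) = a := fun a => by
    induction a using TensorProduct.induction_on with
    | zero => simp
    | add x y hx hy => rw [map_add, map_add, hx, hy]
    | tmul e r => rw [conj_tmul, conj_tmul, hc]
  induction u using TensorProduct.induction_on with
  | zero => simp
  | add x y hx hy => simp only [map_add, LinearMap.add_apply, hx, hy]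
  | tmul a x =>
    induction v using TensorProduct.induction_on with
    | zero => simp
    | add x y hx hy => simp only [map_add, LinearMap.add_apply, hx, hy]
    | tmul b y =>
      rw [form_tmul, form_tmul, map_mul, map_mul, hcc, conj_algebraMap]
      have : c (h x y) = h y x := hh.eq x y
      rw [this]
      ring

variable (F R) in
/-- The basis of `V ⊗ R` over `E ⊗ R` obtained from a basis of `V`. -/
abbrev ptsBasis (b : Basis (Fin d) E V) : Basis (Fin d) (E ⊗[F] R) (Pts F E R V) :=
  b.baseChange (E ⊗[F] R)

variable (F R) in
/-- The Gram matrix of the extended form. -/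
abbrev gramExt (h : V →ₛₗ[(c : E →+* E)] V →ₗ[E] E) (b : Basis (Fin d) E V) :
    Matrix (Fin d) (Fin d) (E ⊗[F] R) :=
  (gram h b).map (algebraMap E (E ⊗[F] R))

lemma form_ptsBasis (h : V →ₛₗ[(c : E →+* E)] V →ₗ[E] E) (b : Basis (Fin d) E V) (i j : Fin d) :
    form R h (ptsBasis F R b i) (ptsBasis F R b j) = gramExt F R h b i j := by
  rw [Basis.baseChange_apply, Basis.baseChange_apply, form_tmul, map_one, one_mul, one_mul]
  rfl

/-- Both sides are sesquilinear, so they are compared on basis vectors. This turns skewness and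
unitarity into matrix identities over `E ⊗ R`. -/
lemma adjoint_iff_matrix {h : V →ₛₗ[(c : E →+* E)] V →ₗ[E] E}
    {k : W →ₛₗ[(c : E →+* E)] W →ₗ[E] E} (b : Basis (Fin d) E V) (b' : Basis (Fin d) E W)
    (X : Pts F E R V →ₗ[E ⊗[F] R] Pts F E R W) (Z : Pts F E R W →ₗ[E ⊗[F] R] Pts F E R V) :
    (∀ u v, form R k (X u) v = form R h u (Z v)) ↔
      ((LinearMap.toMatrix (ptsBasis F R b) (ptsBasis F R b') X).map (conj R c)).transpose *
        gramExt F R k b' =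
      gramExt F R h b * LinearMap.toMatrix (ptsBasis F R b') (ptsBasis F R b) Z := by
  have e1 : ∀ i j, form R k (X (ptsBasis F R b i)) (ptsBasis F R b' j) =
      (((LinearMap.toMatrix (ptsBasis F R b) (ptsBasis F R b') X).map (conj R c)).transpose *
        gramExt F R k b') i j := fun i j => by
    conv_lhs => rw [← (ptsBasis F R b').sum_repr (X (ptsBasis F R b i))]
    rw [map_sum, LinearMap.sum_apply, Matrix.mul_apply]
    refine Finset.sum_congr rfl fun l _ => ?_
    rw [LinearMap.map_smulₛₗ, LinearMap.smul_apply, form_ptsBasis, Matrix.transpose_apply,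
      Matrix.map_apply, LinearMap.toMatrix_apply, smul_eq_mul]
  have e2 : ∀ i j, form R h (ptsBasis F R b i) (Z (ptsBasis F R b' j)) =
      (gramExt F R h b * LinearMap.toMatrix (ptsBasis F R b') (ptsBasis F R b) Z) i j :=
    fun i j => by
    conv_lhs => rw [← (ptsBasis F R b).sum_repr (Z (ptsBasis F R b' j))]
    rw [map_sum, Matrix.mul_apply]
    refine Finset.sum_congr rfl fun l _ => ?_
    rw [map_smul, form_ptsBasis, LinearMap.toMatrix_apply, smul_eq_mul, mul_comm]
  constructor
  · intro H
    ext1 i j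
    rw [← e1, ← e2, H]
  · intro H
    have := LinearMap.ext_basis (ptsBasis F R b) (ptsBasis F R b')
      (B := (form R k).comp X) (B' := (form R h).compl₂ Z) (fun i j => by
        rw [LinearMap.comp_apply, LinearMap.compl₂_apply, e1, e2, H])
    intro u v
    exact LinearMap.congr_fun₂ this u v

lemma toMatrix_neg (b : Basis (Fin d) E V) (b' : Basis (Fin d) E W)
    (X : Pts F E R V →ₗ[E ⊗[F] R] Pts F E R W) :
    LinearMap.toMatrix (ptsBasis F R b) (ptsBasis F R b') (-X) =
      -LinearMap.toMatrix (ptsBasis F R b) (ptsBasis F R b') X := by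
  ext1 i j
  rw [Matrix.neg_apply, LinearMap.toMatrix_apply, LinearMap.toMatrix_apply, LinearMap.neg_apply,
    map_neg, Finsupp.neg_apply]

lemma isUnit_det_gramExt {h : V →ₛₗ[(c : E →+* E)] V →ₗ[E] E} (hn : h.Nondegenerate)
    (b : Basis (Fin d) E V) : IsUnit (gramExt F R h b).det := by
  have := (isUnit_det_gram hn b).map (algebraMap E (E ⊗[F] R))
  rwa [RingHom.map_det] at this

lemma gramExt_transpose {h : V →ₛₗ[(c : E →+* E)] V →ₗ[E] E} (hh : h.IsSymm)
    (b : Basis (Fin d) E V) :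
    (gramExt F R h b).transpose = (gramExt F R h b).map (conj R c) := by
  rw [gramExt, ← Matrix.transpose_map, gram_transpose hh]
  ext i j
  simp only [Matrix.map_apply, conj_algebraMap]

lemma push_ptsBasis (b : Basis (Fin d) E V) (φ : R →ₐ[F] S) (i : Fin d) :
    push E V φ (ptsBasis F R b i) = ptsBasis F S b i := by
  rw [Basis.baseChange_apply, Basis.baseChange_apply, push_tmul, map_one]

lemma repr_push (b : Basis (Fin d) E V) (φ : R →ₐ[F] S) (u : Pts F E R V) (i : Fin d) :
    (ptsBasis F S b).repr (push E V φ u) i = pushScalar E φ ((ptsBasis F R b).repr u i) := by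
  conv_lhs => rw [← (ptsBasis F R b).sum_repr u]
  rw [map_sum]
  simp only [push_smul, push_ptsBasis]
  rw [Basis.repr_sum_self]

/-- The matrix of a map which is compatible with base change is obtained by base change. -/
lemma toMatrix_push (b : Basis (Fin d) E V) (b' : Basis (Fin d) E W) (φ : R →ₐ[F] S)
    (X : Pts F E R V →ₗ[E ⊗[F] R] Pts F E R W) (X' : Pts F E S V →ₗ[E ⊗[F] S] Pts F E S W)
    (H : ∀ u, X' (push E V φ u) = push E W φ (X u)) :
    LinearMap.toMatrix (ptsBasis F S b) (ptsBasis F S b') X' =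
      (LinearMap.toMatrix (ptsBasis F R b) (ptsBasis F R b') X).map (pushScalar E φ) := by
  ext1 i j
  rw [LinearMap.toMatrix_apply, Matrix.map_apply, LinearMap.toMatrix_apply, ← push_ptsBasis b φ,
    H, repr_push]

end Coordinates

/-! ### Block matrices of points of the odd part and of group elements -/

section PairCoordinates

open Module

variable {F E : Type u} [Field F] [Field E] [Algebra F E] {c : E ≃ₐ[F] E}
variable {R S : Type u} [CommRing R] [Algebra F R] [CommRing S] [Algebra F S]
variable {W₁ W₂ : Type u} [AddCommGroup W₁] [Module E W₁] [AddCommGroup W₂] [Module E W₂]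
variable {d : ℕ} (b₁ : Basis (Fin d) E W₁) (b₂ : Basis (Fin d) E W₂)

/-- The matrix of the upper right block. -/
def mat₁₂ (x : Module.End (E ⊗[F] R) (Pts F E R (W₁ × W₂))) : Matrix (Fin d) (Fin d) (E ⊗[F] R) :=
  LinearMap.toMatrix (ptsBasis F R b₂) (ptsBasis F R b₁) (block₁₂ x)

/-- The matrix of the lower left block. -/
def mat₂₁ (x : Module.End (E ⊗[F] R) (Pts F E R (W₁ × W₂))) : Matrix (Fin d) (Fin d) (E ⊗[F] R) :=
  LinearMap.toMatrix (ptsBasis F R b₁) (ptsBasis F R b₂) (block₂₁ x)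

lemma charpoly_contraction (x : Module.End (E ⊗[F] R) (Pts F E R (W₁ × W₂))) [Module.Finite E W₁] :
    (contraction x).charpoly = (mat₁₂ b₁ b₂ x * mat₂₁ b₁ b₂ x).charpoly := by
  rw [mat₁₂, mat₂₁, ← LinearMap.toMatrix_comp, ← LinearMap.charpoly_toMatrix _ (ptsBasis F R b₁)]
  rfl

lemma mat₁₂_endMap (φ : R →ₐ[F] S) (x : Module.End (E ⊗[F] R) (Pts F E R (W₁ × W₂))) :
    mat₁₂ b₁ b₂ (endMap φ x) = (mat₁₂ b₁ b₂ x).map (pushScalar E φ) :=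
  toMatrix_push _ _ _ _ _ fun u => by
    simp only [block₁₂, LinearMap.comp_apply, push_extend, ← endMap_push φ x,
      push_extend φ (LinearMap.inr E W₁ W₂)]

lemma mat₂₁_endMap (φ : R →ₐ[F] S) (x : Module.End (E ⊗[F] R) (Pts F E R (W₁ × W₂))) :
    mat₂₁ b₁ b₂ (endMap φ x) = (mat₂₁ b₁ b₂ x).map (pushScalar E φ) :=
  toMatrix_push _ _ _ _ _ fun u => by
    simp only [block₂₁, LinearMap.comp_apply, push_extend, ← endMap_push φ x,
      push_extend φ (LinearMap.inl E W₁ W₂)]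

variable {h₁ : W₁ →ₛₗ[(c : E →+* E)] W₁ →ₗ[E] E} {h₂ : W₂ →ₛₗ[(c : E →+* E)] W₂ →ₗ[E] E}

lemma mat_adjoint {x : Module.End (E ⊗[F] R) (Pts F E R (W₁ × W₂))} (hx : x ∈ oddPart R h₁ h₂) :
    ((mat₁₂ b₁ b₂ x).map (conj R c)).transpose * gramExt F R h₁ b₁ =
      -(gramExt F R h₂ b₂ * mat₂₁ b₁ b₂ x) := by
  have := (adjoint_iff_matrix b₂ b₁ _ _).mp (block_adjoint hx)
  rw [toMatrix_neg, Matrix.mul_neg] at this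
  exact this

lemma proj₁_invol (u : Pts F E R (W₁ × W₂)) :
    proj₁ F E R W₁ W₂ (extend F R (invol E W₁ W₂) u) = proj₁ F E R W₁ W₂ u := by
  rw [← LinearMap.comp_apply, ← LinearMap.baseChange_comp]; rfl

lemma proj₂_invol (u : Pts F E R (W₁ × W₂)) :
    proj₂ F E R W₁ W₂ (extend F R (invol E W₁ W₂) u) = -proj₂ F E R W₁ W₂ u := by
  rw [← LinearMap.comp_apply, ← LinearMap.baseChange_comp, ← LinearMap.neg_apply,
    ← LinearMap.baseChange_neg]; rfl

lemma invol_inj₁ (u : Pts F E R W₁) :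
    extend F R (invol E W₁ W₂) (inj₁ F E R W₁ W₂ u) = inj₁ F E R W₁ W₂ u := by
  rw [← LinearMap.comp_apply, ← LinearMap.baseChange_comp]
  congr 2
  ext w <;> simp [invol]

lemma invol_inj₂ (u : Pts F E R W₂) :
    extend F R (invol E W₁ W₂) (inj₂ F E R W₁ W₂ u) = -inj₂ F E R W₁ W₂ u := by
  rw [← LinearMap.comp_apply, ← LinearMap.baseChange_comp, ← LinearMap.neg_apply,
    ← LinearMap.baseChange_neg]
  congr 2
  ext w <;> simp [invol]

lemma eq_zero_of_eq_neg (hF : (2 : F) ≠ 0) {M : Type*} [AddCommGroup M] [Module F M] {m : M}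
    (h : m = -m) : m = 0 := by
  have : (2 : F) • m = 0 := by
    rw [two_smul]
    nth_rw 2 [h]
    exact add_neg_cancel m
  exact (smul_eq_zero.mp this).resolve_left hF

/-- An element of the odd part is determined by its off-diagonal blocks. -/
lemma odd_apply (hF : (2 : F) ≠ 0) {x : Module.End (E ⊗[F] R) (Pts F E R (W₁ × W₂))}
    (hx : x ∈ oddPart R h₁ h₂) (u : Pts F E R (W₁ × W₂)) :
    x u = inj₁ F E R W₁ W₂ (block₁₂ x (proj₂ F E R W₁ W₂ u)) +
      inj₂ F E R W₁ W₂ (block₂₁ x (proj₁ F E R W₁ W₂ u)) := by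
  have hs : ∀ v, extend F R (invol E W₁ W₂) (x (extend F R (invol E W₁ W₂) v)) = -x v :=
    fun v => LinearMap.congr_fun hx.2 v
  -- The relation `σ x σ = -x` makes each diagonal block equal to its own negative, hence zero as
  -- `2` is invertible.
  have h1 : ∀ v, proj₁ F E R W₁ W₂ (x (inj₁ F E R W₁ W₂ v)) = 0 := fun v => by
    apply eq_zero_of_eq_neg hF
    have := congrArg (proj₁ F E R W₁ W₂) (hs (inj₁ F E R W₁ W₂ v))
    rwa [invol_inj₁, proj₁_invol, map_neg] at this
  have h2 : ∀ v, proj₂ F E R W₁ W₂ (x (inj₂ F E R W₁ W₂ v)) = 0 := fun v => by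
    apply eq_zero_of_eq_neg hF
    have := congrArg (proj₂ F E R W₁ W₂) (hs (inj₂ F E R W₁ W₂ v))
    rwa [invol_inj₂, proj₂_invol, map_neg, map_neg, neg_neg] at this
  rw [← inj_proj (x u)]
  congr 2
  · conv_lhs => rw [← inj_proj u]
    rw [map_add, map_add, h1, zero_add]
    rfl
  · conv_lhs => rw [← inj_proj u]
    rw [map_add, map_add, h2, add_zero]
    rfl

lemma odd_ext (hF : (2 : F) ≠ 0) {x y : oddPart R h₁ h₂}
    (h12 : mat₁₂ b₁ b₂ x.1 = mat₁₂ b₁ b₂ y.1) (h21 : mat₂₁ b₁ b₂ x.1 = mat₂₁ b₁ b₂ y.1) :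
    x = y := by
  apply Subtype.ext
  apply LinearMap.ext
  intro u
  rw [odd_apply hF x.2, odd_apply hF y.2, (LinearMap.toMatrix _ _).injective h12,
    (LinearMap.toMatrix _ _).injective h21]

/-- Matrices of blocks which are opposite to each other's adjoints come from the odd part. -/
lemma exists_odd (hh₁ : h₁.IsSymm) (hh₂ : h₂.IsSymm) (hc : ∀ e, c (c e) = e)
    {M N : Matrix (Fin d) (Fin d) (E ⊗[F] R)}
    (H : (M.map (conj R c)).transpose * gramExt F R h₁ b₁ = -(gramExt F R h₂ b₂ * N)) :
    ∃ x : oddPart R h₁ h₂, mat₁₂ b₁ b₂ x.1 = M ∧ mat₂₁ b₁ b₂ x.1 = N := by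
  let X := Matrix.toLin (ptsBasis F R b₂) (ptsBasis F R b₁) M
  let Z := Matrix.toLin (ptsBasis F R b₁) (ptsBasis F R b₂) N
  have hX : LinearMap.toMatrix (ptsBasis F R b₂) (ptsBasis F R b₁) X = M :=
    LinearMap.toMatrix_toLin _ _ _
  have hZ : LinearMap.toMatrix (ptsBasis F R b₁) (ptsBasis F R b₂) Z = N :=
    LinearMap.toMatrix_toLin _ _ _
  have hXZ : ∀ v w, form R h₁ (X v) w = -form R h₂ v (Z w) := fun v w => by
    rw [(adjoint_iff_matrix b₂ b₁ (h := h₂) (k := h₁) X (-Z)).mpr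
      (by rw [hX, toMatrix_neg, hZ, Matrix.mul_neg, H]) v w, LinearMap.neg_apply, map_neg]
  -- Skewness on the other pair of summands is the conjugate of `hXZ`, by Hermitian symmetry.
  have hZX : ∀ v w, form R h₂ (Z w) v = -form R h₁ w (X v) := fun v w => by
    rw [← conj_form hh₂ hc, ← conj_form hh₁ hc, hXZ, map_neg, neg_neg]
  let x : Module.End (E ⊗[F] R) (Pts F E R (W₁ × W₂)) :=
    inj₁ F E R W₁ W₂ ∘ₗ X ∘ₗ proj₂ F E R W₁ W₂ + inj₂ F E R W₁ W₂ ∘ₗ Z ∘ₗ proj₁ F E R W₁ W₂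
  have hx : ∀ u, x u = inj₁ F E R W₁ W₂ (X (proj₂ F E R W₁ W₂ u)) +
    inj₂ F E R W₁ W₂ (Z (proj₁ F E R W₁ W₂ u)) := fun u => rfl
  have hx12 : block₁₂ x = X := LinearMap.ext fun u => by
    rw [block₁₂, LinearMap.comp_apply, LinearMap.comp_apply, hx, map_add, proj₁_inj₁, proj₁_inj₂,
      proj₂_inj₂, add_zero]
  have hx21 : block₂₁ x = Z := LinearMap.ext fun u => by
    rw [block₂₁, LinearMap.comp_apply, LinearMap.comp_apply, hx, map_add, proj₂_inj₁, proj₂_inj₂,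
      proj₁_inj₁, zero_add]
  refine ⟨⟨x, fun u v => ?_, LinearMap.ext fun u => ?_⟩, ?_, ?_⟩
  · rw [form_sum, form_sum, hx, hx]
    simp only [map_add, proj₁_inj₁, proj₁_inj₂, proj₂_inj₁, proj₂_inj₂, add_zero, zero_add]
    rw [hXZ, hZX]
    abel
  · rw [Module.End.mul_apply, Module.End.mul_apply, LinearMap.neg_apply, hx, hx, proj₁_invol,
      proj₂_invol, map_add, invol_inj₁, invol_inj₂, map_neg, map_neg, neg_add]
  · rw [mat₁₂, hx12, hX]
  · rw [mat₂₁, hx21, hZ]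

lemma block₁₂_adjoint (g : unitary R h₁ × unitary R h₂) (x : oddPart R h₁ h₂) :
    block₁₂ (adjoint h₁ h₂ g x).1 = g.1.1.val ∘ₗ block₁₂ x.1 ∘ₗ (g⁻¹).2.1.val := by
  apply LinearMap.ext
  intro u
  change proj₁ F E R W₁ W₂ ((pairEmb R h₁ h₂ g).val (x.1 ((pairEmb R h₁ h₂ g⁻¹).val
    (inj₂ F E R W₁ W₂ u)))) = g.1.1.val (proj₁ F E R W₁ W₂ (x.1 (inj₂ F E R W₁ W₂
      ((g⁻¹).2.1.val u))))
  simp only [pairEmb_val, blockDiag, MonoidHom.coe_mk, OneHom.coe_mk, LinearMap.add_apply,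
    LinearMap.comp_apply, map_add, proj₁_inj₁, proj₁_inj₂, proj₂_inj₂, map_zero, zero_add,
    add_zero]

lemma block₂₁_adjoint (g : unitary R h₁ × unitary R h₂) (x : oddPart R h₁ h₂) :
    block₂₁ (adjoint h₁ h₂ g x).1 = g.2.1.val ∘ₗ block₂₁ x.1 ∘ₗ (g⁻¹).1.1.val := by
  apply LinearMap.ext
  intro u
  change proj₂ F E R W₁ W₂ ((pairEmb R h₁ h₂ g).val (x.1 ((pairEmb R h₁ h₂ g⁻¹).val
    (inj₁ F E R W₁ W₂ u)))) = g.2.1.val (proj₂ F E R W₁ W₂ (x.1 (inj₁ F E R W₁ W₂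
      ((g⁻¹).1.1.val u))))
  simp only [pairEmb_val, blockDiag, MonoidHom.coe_mk, OneHom.coe_mk, LinearMap.add_apply,
    LinearMap.comp_apply, map_add, proj₁_inj₁, proj₂_inj₁, proj₂_inj₂, map_zero, zero_add,
    add_zero]

lemma inv_apply_self {h : W₁ →ₛₗ[(c : E →+* E)] W₁ →ₗ[E] E} (g : unitary R h) (u : Pts F E R W₁) :
    (g⁻¹).1.val (g.1.val u) = u := by
  rw [← Module.End.mul_apply]
  change (g.1⁻¹.val * g.1.val) u = u
  rw [Units.inv_mul]
  rfl

lemma mat₁₂_adjoint (g : unitary R h₁ × unitary R h₂) (x : oddPart R h₁ h₂) :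
    mat₁₂ b₁ b₂ (adjoint h₁ h₂ g x).1 *
        LinearMap.toMatrix (ptsBasis F R b₂) (ptsBasis F R b₂) g.2.1.val =
      LinearMap.toMatrix (ptsBasis F R b₁) (ptsBasis F R b₁) g.1.1.val * mat₁₂ b₁ b₂ x.1 := by
  rw [mat₁₂, mat₁₂, ← LinearMap.toMatrix_comp, ← LinearMap.toMatrix_comp, block₁₂_adjoint]
  congr 1
  exact LinearMap.ext fun u => congrArg (fun v => g.1.1.val (block₁₂ x.1 v))
    (inv_apply_self g.2 u)

lemma mat₂₁_adjoint (g : unitary R h₁ × unitary R h₂) (x : oddPart R h₁ h₂) :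
    mat₂₁ b₁ b₂ (adjoint h₁ h₂ g x).1 *
        LinearMap.toMatrix (ptsBasis F R b₁) (ptsBasis F R b₁) g.1.1.val =
      LinearMap.toMatrix (ptsBasis F R b₂) (ptsBasis F R b₂) g.2.1.val * mat₂₁ b₁ b₂ x.1 := by
  rw [mat₂₁, mat₂₁, ← LinearMap.toMatrix_comp, ← LinearMap.toMatrix_comp, block₂₁_adjoint]
  congr 1
  exact LinearMap.ext fun u => congrArg (fun v => g.2.1.val (block₂₁ x.1 v))
    (inv_apply_self g.1 u)

/-- Invertible matrices which preserve the Gram matrix come from the unitary group. -/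
lemma exists_unitary (h : W₁ →ₛₗ[(c : E →+* E)] W₁ →ₗ[E] E) (b : Basis (Fin d) E W₁)
    {G : Matrix (Fin d) (Fin d) (E ⊗[F] R)} (hG : IsUnit G.det)
    (H : (G.map (conj R c)).transpose * gramExt F R h b * G = gramExt F R h b) :
    ∃ g : unitary R h,
      LinearMap.toMatrix (ptsBasis F R b) (ptsBasis F R b) g.1.val = G := by
  let X := Matrix.toLin (ptsBasis F R b) (ptsBasis F R b) G
  let Z := Matrix.toLin (ptsBasis F R b) (ptsBasis F R b) G⁻¹
  have hXZ : X * Z = 1 := by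
    rw [Module.End.mul_eq_comp, ← Matrix.toLin_mul, Matrix.mul_nonsing_inv _ hG, Matrix.toLin_one]
    rfl
  have hZX : Z * X = 1 := by
    rw [Module.End.mul_eq_comp, ← Matrix.toLin_mul, Matrix.nonsing_inv_mul _ hG, Matrix.toLin_one]
    rfl
  have hadj := (adjoint_iff_matrix b b (h := h) (k := h) X Z).mpr (by
    rw [LinearMap.toMatrix_toLin, LinearMap.toMatrix_toLin]
    conv_rhs => rw [← H]
    rw [Matrix.mul_assoc _ G, Matrix.mul_nonsing_inv _ hG, Matrix.mul_one])
  refine ⟨⟨⟨X, Z, hXZ, hZX⟩, fun u v => ?_⟩, LinearMap.toMatrix_toLin _ _ _⟩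
  change form R h (X u) (X v) = form R h u v
  rw [hadj, ← Module.End.mul_apply, hZX]
  rfl

end PairCoordinates

/-! ## The invariants -/

section Invariants

open Module

variable {F E : Type u} [Field F] [Field E] [Algebra F E] [Algebra.IsQuadraticExtension F E]
variable {c : E ≃ₐ[F] E}
variable {R S : Type u} [CommRing R] [Algebra F R] [CommRing S] [Algebra F S]
variable {W₁ W₂ : Type u} [AddCommGroup W₁] [Module E W₁] [Module.Finite E W₁]
  [AddCommGroup W₂] [Module E W₂]
variable {d : ℕ}
variable {h₁ : W₁ →ₛₗ[(c : E →+* E)] W₁ →ₗ[E] E} {h₂ : W₂ →ₛₗ[(c : E →+* E)] W₂ →ₗ[E] E}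

omit [Algebra.IsQuadraticExtension F E] in
lemma charpoly_eq_of_mul_eq_mul {A : Type*} [CommRing A] {H M N : Matrix (Fin d) (Fin d) A}
    (hH : IsUnit H.det) (h : H * M = N * H) : M.charpoly = N.charpoly := by
  have : M = H⁻¹ * (N * H) := by rw [← h, ← mul_assoc, Matrix.nonsing_inv_mul _ hH, one_mul]
  rw [this, Matrix.charpoly_mul_comm, mul_assoc, Matrix.mul_nonsing_inv _ hH, mul_one]

/-- `X X^*` is self-adjoint: in matrices, the Gram matrix of `h₁` conjugates `M N` into its
conjugate transpose, and transposition preserves the characteristic polynomial. -/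
lemma charpoly_contraction_conj (b₁ : Basis (Fin d) E W₁) (b₂ : Basis (Fin d) E W₂)
    (hh₁ : h₁.IsSymm) (hn₁ : h₁.Nondegenerate) (hh₂ : h₂.IsSymm) (x : oddPart R h₁ h₂) :
    (contraction x.1).charpoly.map (conj R c) = (contraction x.1).charpoly := by
  rw [charpoly_contraction b₁ b₂, ← Matrix.charpoly_map]
  have e := mat_adjoint b₁ b₂ x.2
  set M := mat₁₂ b₁ b₂ x.1
  set N := mat₂₁ b₁ b₂ x.1
  have hcc : ∀ A : Matrix (Fin d) (Fin d) (E ⊗[F] R),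
      (A.map (conj R c)).map (conj R c) = A := fun A => by ext1 i j; exact conj_conj c _
  have e' : gramExt F R h₁ b₁ * M = -((N.map (conj R c)).transpose * gramExt F R h₂ b₂) := by
    have := congrArg (fun A => (Matrix.transpose A).map (conj R c)) e
    simp only [Matrix.transpose_mul, Matrix.transpose_neg, Matrix.transpose_transpose,
      gramExt_transpose hh₁, gramExt_transpose hh₂, Matrix.map_mul] at this
    rw [hcc, hcc] at this
    rw [this]
    ext1 i j
    simp only [Matrix.map_apply, Matrix.neg_apply, map_neg]
    rw [← Matrix.map_apply (f := conj R c), Matrix.map_mul, hcc]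
    rfl
  rw [Matrix.map_mul, ← Matrix.charpoly_transpose]
  refine (charpoly_eq_of_mul_eq_mul (isUnit_det_gramExt hn₁ b₁) ?_).symm
  rw [← mul_assoc, e', Matrix.transpose_mul, mul_assoc, e, neg_mul, mul_neg, mul_assoc]

lemma exists_coeff (hF : (2 : F) ≠ 0) (hc : c ≠ AlgEquiv.refl)
    (b₁ : Basis (Fin d) E W₁) (b₂ : Basis (Fin d) E W₂) (hh₁ : h₁.IsSymm)
    (hn₁ : h₁.Nondegenerate) (hh₂ : h₂.IsSymm) (x : oddPart R h₁ h₂) (i : Fin d) :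
    ∃ r : R, (1 : E) ⊗ₜ[F] r = (contraction x.1).charpoly.coeff i :=
  exists_tmul_of_conj_eq hF hc (by
    rw [← Polynomial.coeff_map, charpoly_contraction_conj b₁ b₂ hh₁ hn₁ hh₂])

omit [Algebra.IsQuadraticExtension F E] in
lemma charpoly_contraction_oddMap (b₁ : Basis (Fin d) E W₁) (b₂ : Basis (Fin d) E W₂)
    (φ : R →ₐ[F] S) (x : oddPart R h₁ h₂) : (contraction (oddMap h₁ h₂ φ x).1).charpoly =
      (contraction x.1).charpoly.map (pushScalar E φ).toRingHom := by
  rw [charpoly_contraction b₁ b₂, charpoly_contraction b₁ b₂, ← Matrix.charpoly_map,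
    Matrix.map_mul, oddMap, mat₁₂_endMap, mat₂₁_endMap]
  rfl

-- The factors from `U(W₂)` cancel in the product of the two blocks, leaving a conjugation by the
-- element of `U(W₁)`.
omit [Algebra.IsQuadraticExtension F E] in
lemma charpoly_contraction_adjoint (g : unitary R h₁ × unitary R h₂) (x : oddPart R h₁ h₂) :
    (contraction (adjoint h₁ h₂ g x).1).charpoly = (contraction x.1).charpoly := by
  have : contraction (adjoint h₁ h₂ g x).1 =
      (g.1.1.val : Module.End _ _) * contraction x.1 * g.1.1⁻¹.val := by
    rw [contraction, block₁₂_adjoint, block₂₁_adjoint]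
    refine LinearMap.ext fun u => congrArg (fun v => g.1.1.val (block₁₂ x.1 v)) ?_
    exact inv_apply_self g.2 _
  rw [this]
  exact LinearEquiv.charpoly_conj (LinearMap.GeneralLinearGroup.toLinearEquiv g.1.1)
    (contraction x.1)

/-- The morphism `π`, whose components are the coefficients of the characteristic polynomial. -/
def invariantMap (hF : (2 : F) ≠ 0) (hc : c ≠ AlgEquiv.refl)
    (b₁ : Basis (Fin d) E W₁) (b₂ : Basis (Fin d) E W₂) (hh₁ : h₁.IsSymm)
    (hn₁ : h₁.Nondegenerate) (hh₂ : h₂.IsSymm) : oddFunctor h₁ h₂ ⟶ affineSpace F d where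
  app R := ↾fun (x : oddPart R h₁ h₂) (i : Fin d) =>
    (exists_coeff hF hc b₁ b₂ hh₁ hn₁ hh₂ x i).choose
  naturality R S φ := ConcreteCategory.hom_ext _ _ fun (x : oddPart R h₁ h₂) => funext fun i => by
    apply one_tmul_injective (F := F) (E := E)
    have e1 := (exists_coeff hF hc b₁ b₂ hh₁ hn₁ hh₂ (oddMap h₁ h₂ φ.hom x) i).choose_spec
    have e2 := (exists_coeff hF hc b₁ b₂ hh₁ hn₁ hh₂ x i).choose_spec
    refine e1.trans ?_
    rw [charpoly_contraction_oddMap b₁ b₂, Polynomial.coeff_map, ← e2]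
    change pushScalar E φ.hom _ = _
    rw [Algebra.TensorProduct.map_tmul, map_one]
    rfl

lemma invariantMap_spec (hF : (2 : F) ≠ 0) (hc : c ≠ AlgEquiv.refl)
    (b₁ : Basis (Fin d) E W₁) (b₂ : Basis (Fin d) E W₂) (hh₁ : h₁.IsSymm)
    (hn₁ : h₁.Nondegenerate) (hh₂ : h₂.IsSymm) (R : CommAlgCat.{u} F) (x : oddPart R h₁ h₂)
    (i : Fin d) : (1 : E) ⊗ₜ[F]
      ((invariantMap hF hc b₁ b₂ hh₁ hn₁ hh₂).app R x : Fin d → R) i =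
        (contraction x.1).charpoly.coeff i :=
  (exists_coeff hF hc b₁ b₂ hh₁ hn₁ hh₂ x i).choose_spec

end Invariants

/-! ## Coordinates over algebras which contain `E` -/

section Split

open Module

variable {F E : Type u} [Field F] [Field E] [Algebra F E]
variable {c : E ≃ₐ[F] E}
variable {R S : Type u} [CommRing R] [Algebra F R] [CommRing S] [Algebra F S]
variable {V : Type u} [AddCommGroup V] [Module E V]
variable {W₁ W₂ : Type u} [AddCommGroup W₁] [Module E W₁]
  [AddCommGroup W₂] [Module E W₂]
variable {d : ℕ}
variable {h₁ : W₁ →ₛₗ[(c : E →+* E)] W₁ →ₗ[E] E} {h₂ : W₂ →ₛₗ[(c : E →+* E)] W₂ →ₗ[E] E}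
variable (b₁ : Basis (Fin d) E W₁) (b₂ : Basis (Fin d) E W₂)

/-- The first matrix coordinate of a point over an algebra which contains `E`. -/
def coordA (ι : E →ₐ[F] R) (x : oddPart R h₁ h₂) : Matrix (Fin d) (Fin d) R :=
  (mat₁₂ b₁ b₂ x.1).map (contr ι)

/-- The second matrix coordinate of a point over an algebra which contains `E`. -/
def coordB (ι : E →ₐ[F] R) (x : oddPart R h₁ h₂) : Matrix (Fin d) (Fin d) R :=
  (mat₂₁ b₁ b₂ x.1).map (contr ι)

lemma coordA_oddMap (ι : E →ₐ[F] R) (φ : R →ₐ[F] S) (x : oddPart R h₁ h₂) :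
    coordA b₁ b₂ (φ.comp ι) (oddMap h₁ h₂ φ x) = (coordA b₁ b₂ ι x).map φ := by
  rw [coordA, oddMap, mat₁₂_endMap]
  ext1 i j
  exact contr_pushScalar ι φ _

lemma coordB_oddMap (ι : E →ₐ[F] R) (φ : R →ₐ[F] S) (x : oddPart R h₁ h₂) :
    coordB b₁ b₂ (φ.comp ι) (oddMap h₁ h₂ φ x) = (coordB b₁ b₂ ι x).map φ := by
  rw [coordB, oddMap, mat₂₁_endMap]
  ext1 i j
  exact contr_pushScalar ι φ _

lemma charpoly_coord [Module.Finite E W₁] (ι : E →ₐ[F] R) (x : oddPart R h₁ h₂) :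
    (coordA b₁ b₂ ι x * coordB b₁ b₂ ι x).charpoly =
      (contraction x.1).charpoly.map (contr ι).toRingHom := by
  rw [charpoly_contraction b₁ b₂, ← Matrix.charpoly_map, Matrix.map_mul]
  rfl

lemma contr_gramExt (ι : E →ₐ[F] R) (h : V →ₛₗ[(c : E →+* E)] V →ₗ[E] E)
    (b : Basis (Fin d) E V) : (gramExt F R h b).map (contr ι) = (gram h b).map ι := by
  ext1 i j
  rw [Matrix.map_apply, Matrix.map_apply]
  change contr ι (algebraMap E (E ⊗[F] R) (gram h b i j)) = _
  rw [Algebra.TensorProduct.algebraMap_apply, contr_tmul, mul_one]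
  rfl

lemma isUnit_det_gram_map (ι : E →ₐ[F] R) {h : V →ₛₗ[(c : E →+* E)] V →ₗ[E] E}
    (hn : h.Nondegenerate) (b : Basis (Fin d) E V) : IsUnit ((gram h b).map ι).det := by
  have := (isUnit_det_gram hn b).map ι.toRingHom
  rwa [RingHom.map_det] at this

variable [Algebra.IsQuadraticExtension F E]

omit [Algebra.IsQuadraticExtension F E] in
/-- A point of the odd part is determined by its upper right block. -/
lemma odd_ext_mat₁₂ (hF : (2 : F) ≠ 0) (hn₂ : h₂.Nondegenerate) {x y : oddPart R h₁ h₂}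
    (hM : mat₁₂ b₁ b₂ x.1 = mat₁₂ b₁ b₂ y.1) : x = y := by
  refine odd_ext b₁ b₂ hF hM ?_
  have := mat_adjoint b₁ b₂ x.2
  rw [hM, mat_adjoint b₁ b₂ y.2] at this
  have := congrArg ((gramExt F R h₂ b₂)⁻¹ * ·) (neg_injective this).symm
  simpa only [← mul_assoc, Matrix.nonsing_inv_mul _ (isUnit_det_gramExt hn₂ b₂),
    one_mul] using this

/-- The upper right block of a point of the odd part is arbitrary. -/
lemma exists_odd_mat₁₂ (hh₁ : h₁.IsSymm) (hh₂ : h₂.IsSymm) (hn₂ : h₂.Nondegenerate)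
    (M : Matrix (Fin d) (Fin d) (E ⊗[F] R)) : ∃ x : oddPart R h₁ h₂, mat₁₂ b₁ b₂ x.1 = M := by
  obtain ⟨x, hx, -⟩ := exists_odd b₁ b₂ hh₁ hh₂ (conj_involutive c) (M := M)
    (N := -((gramExt F R h₂ b₂)⁻¹ * ((M.map (conj R c)).transpose * gramExt F R h₁ b₁))) (by
      rw [mul_neg, neg_neg, ← mul_assoc, Matrix.mul_nonsing_inv _ (isUnit_det_gramExt hn₂ b₂),
        one_mul])
  exact ⟨x, hx⟩

lemma matrix_ext (hF : (2 : F) ≠ 0) (hc : c ≠ AlgEquiv.refl) (ι : E →ₐ[F] R)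
    {M N : Matrix (Fin d) (Fin d) (E ⊗[F] R)} (h : M.map (contr ι) = N.map (contr ι))
    (h' : (M.map (conj R c)).map (contr ι) = (N.map (conj R c)).map (contr ι)) : M = N := by
  ext1 i j
  exact (contr_prod_bijective hF hc ι).1
    (Prod.ext (congrFun (congrFun h i) j) (congrFun (congrFun h' i) j))

lemma exists_matrix (hF : (2 : F) ≠ 0) (hc : c ≠ AlgEquiv.refl) (ι : E →ₐ[F] R)
    (A B : Matrix (Fin d) (Fin d) R) : ∃ M : Matrix (Fin d) (Fin d) (E ⊗[F] R),
      M.map (contr ι) = A ∧ (M.map (conj R c)).map (contr ι) = B := by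
  choose M hM using fun i j => (contr_prod_bijective hF hc ι).2 (A i j, B i j)
  exact ⟨Matrix.of M, by ext1 i j; exact congrArg Prod.fst (hM i j),
    by ext1 i j; exact congrArg Prod.snd (hM i j)⟩

/-- Under `E ⊗ R = R × R` the upper right block is a pair of matrices. The first is `coordA`; by
`mat_adjoint`, the second is `coordB` up to sign, transposition and invertible Gram matrices. -/
lemma coord_ext (hF : (2 : F) ≠ 0) (hc : c ≠ AlgEquiv.refl) (hn₁ : h₁.Nondegenerate)
    (hn₂ : h₂.Nondegenerate) (ι : E →ₐ[F] R) {x y : oddPart R h₁ h₂}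
    (hA : coordA b₁ b₂ ι x = coordA b₁ b₂ ι y) (hB : coordB b₁ b₂ ι x = coordB b₁ b₂ ι y) :
    x = y := by
  have hM : mat₁₂ b₁ b₂ x.1 = mat₁₂ b₁ b₂ y.1 := by
    refine matrix_ext hF hc ι hA ?_
    have e : ∀ z : oddPart R h₁ h₂, (((mat₁₂ b₁ b₂ z.1).map (conj R c)).map (contr ι)).transpose *
        (gramExt F R h₁ b₁).map (contr ι) =
          ((-gramExt F R h₂ b₂).map (contr ι)) * coordB b₁ b₂ ι z := fun z => by
      have := mat_adjoint b₁ b₂ z.2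
      rw [← Matrix.neg_mul] at this
      have := congrArg (fun A => A.map (contr ι)) this
      rwa [Matrix.map_mul, Matrix.map_mul] at this
    have := (e x).trans ((congrArg _ hB).trans (e y).symm)
    rw [contr_gramExt] at this
    have := congrArg (· * ((gram h₁ b₁).map ι)⁻¹) this
    simp only [mul_assoc, Matrix.mul_nonsing_inv _ (isUnit_det_gram_map ι hn₁ b₁), mul_one] at this
    exact Matrix.transpose_injective this
  exact odd_ext_mat₁₂ b₁ b₂ hF hn₂ hM

lemma exists_coord (hF : (2 : F) ≠ 0) (hc : c ≠ AlgEquiv.refl) (hh₁ : h₁.IsSymm)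
    (hn₁ : h₁.Nondegenerate) (hh₂ : h₂.IsSymm) (hn₂ : h₂.Nondegenerate) (ι : E →ₐ[F] R)
    (A B : Matrix (Fin d) (Fin d) R) :
    ∃ x : oddPart R h₁ h₂, coordA b₁ b₂ ι x = A ∧ coordB b₁ b₂ ι x = B := by
  have u₁ := isUnit_det_gram_map ι hn₁ b₁
  have u₂ := isUnit_det_gram_map ι hn₂ b₂
  obtain ⟨M, hM, hM'⟩ := exists_matrix (c := c) hF hc ι A
    -- The second component of `M` is forced by `mat_adjoint` once the lower left block is to have
    -- coordinate `B`.
    (-((gram h₂ b₂).map ι * B * ((gram h₁ b₁).map ι)⁻¹)).transpose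
  obtain ⟨x, hx⟩ := exists_odd_mat₁₂ b₁ b₂ hh₁ hh₂ hn₂ M
  refine ⟨x, by rw [coordA, hx, hM], ?_⟩
  have := congrArg (fun A => A.map (contr ι)) (mat_adjoint b₁ b₂ x.2)
  rw [hx, ← mul_neg] at this
  simp only [Matrix.map_mul, contr_gramExt] at this
  rw [Matrix.transpose_map, hM', Matrix.transpose_transpose, neg_mul, mul_assoc _ _⁻¹ ,
    Matrix.nonsing_inv_mul _ u₁, mul_one, ← mul_neg] at this
  have := congrArg (((gram h₂ b₂).map ι)⁻¹ * ·) this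
  simp only [← mul_assoc, Matrix.nonsing_inv_mul _ u₂, one_mul] at this
  rw [← neg_neg B, this]
  ext i j
  simp [coordB]

/-- Under `E ⊗ R = R × R` the unitarity of `G` determines its second component from the first, `P`,
which remains arbitrary: the unitary group becomes `GL_d`. -/
lemma exists_unitary_coord (hF : (2 : F) ≠ 0) (hc : c ≠ AlgEquiv.refl)
    {h : V →ₛₗ[(c : E →+* E)] V →ₗ[E] E} (hh : h.IsSymm) (hn : h.Nondegenerate)
    (b : Basis (Fin d) E V) (ι : E →ₐ[F] R) {P : Matrix (Fin d) (Fin d) R} (hP : IsUnit P.det) :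
    ∃ g : unitary R h,
      (LinearMap.toMatrix (ptsBasis F R b) (ptsBasis F R b) g.1.val).map (contr ι) = P := by
  have u := isUnit_det_gram_map ι hn b
  obtain ⟨G, hG, hG'⟩ := exists_matrix (c := c) hF hc ι P
    ((gram h b).map ι * P⁻¹ * ((gram h b).map ι)⁻¹).transpose
  have key : ((gram h b).map ι * P⁻¹ * ((gram h b).map ι)⁻¹) * (gram h b).map ι * P =
      (gram h b).map ι := by
    rw [mul_assoc _ _⁻¹, Matrix.nonsing_inv_mul _ u, mul_one, mul_assoc,
      Matrix.nonsing_inv_mul _ hP, mul_one]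
  have H : (G.map (conj R c)).transpose * gramExt F R h b * G = gramExt F R h b := by
    apply matrix_ext (c := c) hF hc ι
    · rw [Matrix.map_mul, Matrix.map_mul, contr_gramExt, Matrix.transpose_map, hG, hG',
        Matrix.transpose_transpose, key]
    -- The second component of the identity is the transpose of the first, because the Gram matrix
    -- is Hermitian.
    · have hcc : (G.map (conj R c)).map (conj R c) = G := by ext1 i j; exact conj_conj c _
      simp only [Matrix.map_mul, ← gramExt_transpose hh, Matrix.transpose_map, hcc, hG, hG',
        contr_gramExt]
      rw [← Matrix.transpose_mul, ← Matrix.transpose_mul, ← mul_assoc, key]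
  have hu : IsUnit G.det := by
    have := isUnit_det_gramExt (R := R) hn b
    rw [← H, Matrix.det_mul] at this
    exact isUnit_of_mul_isUnit_right this
  obtain ⟨g, hg⟩ := exists_unitary h b hu H
  exact ⟨g, by rw [hg, hG]⟩

/-- Over an algebra which contains `E`, equivalent pairs of matrices are in the same orbit. -/
lemma exists_adjoint_eq (hF : (2 : F) ≠ 0) (hc : c ≠ AlgEquiv.refl) (hh₁ : h₁.IsSymm)
    (hn₁ : h₁.Nondegenerate) (hh₂ : h₂.IsSymm) (hn₂ : h₂.Nondegenerate) (ι : E →ₐ[F] R)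
    {x x' : oddPart R h₁ h₂} {P Q : Matrix (Fin d) (Fin d) R} (hP : IsUnit P.det)
    (hQ : IsUnit Q.det) (hA : coordA b₁ b₂ ι x' * Q = P * coordA b₁ b₂ ι x)
    (hB : coordB b₁ b₂ ι x' * P = Q * coordB b₁ b₂ ι x) :
    ∃ g : unitary R h₁ × unitary R h₂, adjoint h₁ h₂ g x = x' := by
  obtain ⟨g₁, hg₁⟩ := exists_unitary_coord hF hc hh₁ hn₁ b₁ ι hP
  obtain ⟨g₂, hg₂⟩ := exists_unitary_coord hF hc hh₂ hn₂ b₂ ι hQ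
  have cancel : ∀ {M N G : Matrix (Fin d) (Fin d) R}, IsUnit G.det → M * G = N * G → M = N :=
    fun {_ _ G} hG h => by
      have := congrArg (· * G⁻¹) h
      simpa only [mul_assoc, Matrix.mul_nonsing_inv _ hG, mul_one] using this
  refine ⟨(g₁, g₂), coord_ext b₁ b₂ hF hc hn₁ hn₂ ι (cancel hQ ?_) (cancel hP ?_)⟩
  · have := congrArg (fun A => A.map (contr ι)) (mat₁₂_adjoint b₁ b₂ (g₁, g₂) x)
    simp only [Matrix.map_mul, hg₁, hg₂] at this
    exact this.trans hA.symm
  · have := congrArg (fun A => A.map (contr ι)) (mat₂₁_adjoint b₁ b₂ (g₁, g₂) x)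
    simp only [Matrix.map_mul, hg₁, hg₂] at this
    exact this.trans hB.symm

end Split

/-! ## The quotient -/

section CharpolyLemmas

open Polynomial

variable {A : Type*} [CommRing A] {d : ℕ}

lemma charpoly_eq_of_coeff_eq {M N : Matrix (Fin d) (Fin d) A}
    (h : ∀ i : Fin d, M.charpoly.coeff i = N.charpoly.coeff i) : M.charpoly = N.charpoly := by
  nontriviality A
  have hdeg : ∀ M : Matrix (Fin d) (Fin d) A, M.charpoly.natDegree = d := fun M => by
    rw [Matrix.charpoly_natDegree_eq_dim, Fintype.card_fin]
  ext i
  rcases lt_trichotomy i d with hi | rfl | hi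
  · exact h ⟨i, hi⟩
  · have hc : ∀ M : Matrix (Fin i) (Fin i) A, M.charpoly.coeff i = 1 := fun M => by
      have := M.charpoly_monic.coeff_natDegree
      rwa [hdeg] at this
    rw [hc, hc]
  · rw [coeff_eq_zero_of_natDegree_lt ((hdeg M).trans_lt hi),
      coeff_eq_zero_of_natDegree_lt ((hdeg N).trans_lt hi)]

/-- Each monic polynomial is a characteristic polynomial. -/
lemma exists_charpoly_eq {p : A[X]} (hp : p.Monic) (hd : p.natDegree = d) :
    ∃ M : Matrix (Fin d) (Fin d) A, M.charpoly = p := by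
  nontriviality A
  subst hd
  -- `M` is multiplication by the root on `A[X]/(p)`. By Cayley–Hamilton its characteristic
  -- polynomial vanishes at the root, so `p` divides it; both are monic of the same degree.
  let M := Algebra.leftMulMatrix (AdjoinRoot.powerBasis' hp).basis (AdjoinRoot.root p)
  refine ⟨M, (eq_of_monic_of_dvd_of_natDegree_le hp M.charpoly_monic ?_ ?_)⟩
  · rw [← AdjoinRoot.mk_eq_zero, ← AdjoinRoot.aeval_eq]
    apply (injective_iff_map_eq_zero _).mp
      (Algebra.leftMulMatrix_injective (AdjoinRoot.powerBasis' hp).basis)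
    rw [← aeval_algHom_apply]
    exact Matrix.aeval_self_charpoly M
  · exact (M.charpoly_natDegree_eq_dim.trans (Fintype.card_fin _)).le

end CharpolyLemmas

/-! ### Constancy on geometric fibres and the section over the split ring -/

section Quotient

open Module

variable {F E : Type u} [Field F] [Field E] [Algebra F E] [Algebra.IsQuadraticExtension F E]
variable {c : E ≃ₐ[F] E}
variable {R S : Type u} [CommRing R] [Algebra F R] [CommRing S] [Algebra F S]
variable {W₁ W₂ : Type u} [AddCommGroup W₁] [Module E W₁] [Module.Finite E W₁]
  [AddCommGroup W₂] [Module E W₂]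
variable {d : ℕ}
variable {h₁ : W₁ →ₛₗ[(c : E →+* E)] W₁ →ₗ[E] E} {h₂ : W₂ →ₛₗ[(c : E →+* E)] W₂ →ₗ[E] E}
variable {Y : Over (AlgebraicGeometry.Spec (CommRingCat.of F))}

/-- The value at a point of a morphism from the odd part. -/
def oddValue (f : oddFunctor h₁ h₂ ⟶ schemePoints Y) (x : oddPart R h₁ h₂) :
    (schemePoints Y).obj (CommAlgCat.of F R) :=
  f.app (CommAlgCat.of F R) x

omit [Algebra.IsQuadraticExtension F E] [Module.Finite E W₁] in
lemma oddValue_oddMap (f : oddFunctor h₁ h₂ ⟶ schemePoints Y) (φ : R →ₐ[F] S)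
    (x : oddPart R h₁ h₂) : oddValue f (oddMap h₁ h₂ φ x) =
      (schemePoints Y).map (CommAlgCat.ofHom φ) (oddValue f x) := by
  have h := ConcreteCategory.congr_hom (f.naturality (CommAlgCat.ofHom φ)) x
  exact h

/-- Over an algebraically closed field, invariant morphisms only depend on the characteristic
polynomial of the contraction. -/
lemma oddValue_eq_of_charpoly_eq (hF : (2 : F) ≠ 0) (hc : c ≠ AlgEquiv.refl)
    (b₁ : Basis (Fin d) E W₁) (b₂ : Basis (Fin d) E W₂) (hh₁ : h₁.IsSymm)
    (hn₁ : h₁.Nondegenerate) (hh₂ : h₂.IsSymm) (hn₂ : h₂.Nondegenerate)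
    (f : oddFunctor h₁ h₂ ⟶ schemePoints Y) (hf : (adjointAction h₁ h₂).IsInvariant f)
    {K : Type u} [Field K] [IsAlgClosed K] [Algebra F K] {x x' : oddPart K h₁ h₂}
    (h : (contraction x.1).charpoly = (contraction x'.1).charpoly) :
    oddValue f x = oddValue f x' := by
  let ι : E →ₐ[F] K := IsAlgClosed.lift
  choose pt hptA hptB using fun A B : Matrix (Fin d) (Fin d) K =>
    exists_coord b₁ b₂ hF hc hh₁ hn₁ hh₂ hn₂ ι A B
  have hr : IsDegenerationInvariant fun A B => oddValue f (pt A B) := by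
    intro A B A' B' P Q hP hQ hA hB
    let i : K →ₐ[F] PowerSeries K := { PowerSeries.C (R := K) with
      commutes' := fun _ => PowerSeries.algebraMap_apply.symm }
    let e : PowerSeries K →ₐ[F] K :=
      { PowerSeries.constantCoeff (R := K) with
        commutes' := fun r => PowerSeries.constantCoeff_C (algebraMap F K r) }
    have hei : e.comp i = AlgHom.id F K := AlgHom.ext fun r => PowerSeries.constantCoeff_C r
    let L := FractionRing (PowerSeries K)
    let j : PowerSeries K →ₐ[F] L := IsScalarTower.toAlgHom F (PowerSeries K) L
    have hj : Function.Injective j := IsFractionRing.injective (PowerSeries K) L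
    -- The family `(A', B')` is a `K⟦X⟧`-point `y` of the odd part. Over the fraction field `P` and
    -- `Q` become invertible, so there `y` lies in the orbit of the constant point `pt A B`.
    obtain ⟨y, hyA, hyB⟩ := exists_coord b₁ b₂ hF hc hh₁ hn₁ hh₂ hn₂ (i.comp ι) A' B'
    have hy : oddMap h₁ h₂ e y = pt (A'.map (PowerSeries.constantCoeff (R := K)))
        (B'.map (PowerSeries.constantCoeff (R := K))) := by
      have he : e.comp (i.comp ι) = ι := by rw [← AlgHom.comp_assoc, hei]; rfl
      have eA := coordA_oddMap b₁ b₂ (i.comp ι) e y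
      have eB := coordB_oddMap b₁ b₂ (i.comp ι) e y
      rw [he] at eA eB
      refine coord_ext b₁ b₂ hF hc hn₁ hn₂ ι ?_ ?_
      · rw [eA, hyA, hptA]; rfl
      · rw [eB, hyB, hptB]; rfl
    have hunit : ∀ {N : Matrix (Fin d) (Fin d) (PowerSeries K)}, N.det ≠ 0 →
        IsUnit (N.map j).det := fun {N} hN => by
      have : (N.map j).det = j N.det := (RingHom.map_det j.toRingHom N).symm
      rw [this, isUnit_iff_ne_zero]
      exact (map_ne_zero_iff j hj).mpr hN
    obtain ⟨g, hg⟩ := exists_adjoint_eq b₁ b₂ hF hc hh₁ hn₁ hh₂ hn₂ (j.comp (i.comp ι))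
      (x := oddMap h₁ h₂ (j.comp i) (pt A B)) (x' := oddMap h₁ h₂ j y) (hunit hP) (hunit hQ)
      (by
        rw [coordA_oddMap, hyA, ← AlgHom.comp_assoc, coordA_oddMap, hptA, ← Matrix.map_mul, hA,
          Matrix.map_mul]
        rfl)
      (by
        rw [coordB_oddMap, hyB, ← AlgHom.comp_assoc, coordB_oddMap, hptB, ← Matrix.map_mul, hB,
          Matrix.map_mul]
        rfl)
    have hinv : oddValue f (oddMap h₁ h₂ j y) = oddValue f (oddMap h₁ h₂ (j.comp i) (pt A B)) := by
      rw [← hg]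
      exact hf (CommAlgCat.of F L) g _
    rw [oddValue_oddMap, oddValue_oddMap] at hinv
    have := points_specialize i j hj e hei _ _ hinv
    rwa [← oddValue_oddMap, hy] at this
  have hpt : ∀ z : oddPart K h₁ h₂, pt (coordA b₁ b₂ ι z) (coordB b₁ b₂ ι z) = z := fun z =>
    coord_ext b₁ b₂ hF hc hn₁ hn₂ ι (hptA _ _) (hptB _ _)
  rw [← hpt x, ← hpt x']
  refine hr.eq_of_charpoly_eq ?_
  rw [charpoly_coord, charpoly_coord, h]

omit [Module.Finite E W₁] in
/-- Points of the odd part lift to points with values in reduced algebras. -/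
lemma exists_reduced_lift (hF : (2 : F) ≠ 0)
    (b₁ : Basis (Fin d) E W₁) (b₂ : Basis (Fin d) E W₂) (hh₁ : h₁.IsSymm)
    (hh₂ : h₂.IsSymm) (hn₂ : h₂.Nondegenerate) (x : oddPart R h₁ h₂) :
    ∃ (A : Type u) (_ : CommRing A) (_ : Algebra F A) (_ : IsReduced A) (θ : A →ₐ[F] R)
      (y : oddPart A h₁ h₂), oddMap h₁ h₂ θ y = x := by
  -- The polynomial ring on the underlying set of `R` is a reduced algebra mapping onto `R`. Points
  -- of the odd part are free matrices `M`, so they lift entry by entry.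
  let θ : MvPolynomial R F →ₐ[F] R := MvPolynomial.aeval id
  have hθ : Function.Surjective θ := fun r => ⟨MvPolynomial.X r, MvPolynomial.aeval_X _ _⟩
  have hs : Function.Surjective (pushScalar E θ) := fun a => by
    induction a using TensorProduct.induction_on with
    | zero => exact ⟨0, map_zero _⟩
    | add a b ha hb =>
      obtain ⟨a, rfl⟩ := ha
      obtain ⟨b, rfl⟩ := hb
      exact ⟨a + b, map_add _ _ _⟩
    | tmul e r =>
      obtain ⟨p, rfl⟩ := hθ r
      exact ⟨e ⊗ₜ p, by simp⟩
  choose M hM using fun i j => hs (mat₁₂ b₁ b₂ x.1 i j)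
  obtain ⟨y, hy⟩ := exists_odd_mat₁₂ b₁ b₂ hh₁ hh₂ hn₂ (Matrix.of M)
  refine ⟨MvPolynomial R F, inferInstance, inferInstance, inferInstance, θ, y,
    odd_ext_mat₁₂ b₁ b₂ hF hn₂ ?_⟩
  rw [oddMap, mat₁₂_endMap, hy]
  ext1 i j
  exact hM i j

variable (F E d) in
/-- The scalar extension to `E` of the coordinate ring of the affine space. -/
abbrev SplitRing : Type u := MvPolynomial (Fin d) F ⊗[F] E

omit [Algebra.IsQuadraticExtension F E] in
lemma isReduced_splitRing : IsReduced (SplitRing F E d) := by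
  let e : SplitRing F E d ≃ₐ[F] MvPolynomial (Fin d) E :=
    (Algebra.TensorProduct.comm F _ _).trans
      ((MvPolynomial.algebraTensorAlgEquiv F E).restrictScalars F)
  exact isReduced_of_injective e.toRingEquiv.toRingHom e.injective

/-- Cancelling the base change identifies this ring with `E ⊗ B`, where `B` is the split ring; `B`
contains `E`, so `isReduced_tensor` applies. -/
lemma isReduced_splitRing_tensor (hF : (2 : F) ≠ 0) (hc : c ≠ AlgEquiv.refl) :
    IsReduced (SplitRing F E d ⊗[MvPolynomial (Fin d) F] SplitRing F E d) := by
  have := isReduced_splitRing (F := F) (E := E) (d := d)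
  have := isReduced_tensor hF hc
    (Algebra.TensorProduct.includeRight : E →ₐ[F] SplitRing F E d)
  let e₁ := Algebra.TensorProduct.cancelBaseChange F (MvPolynomial (Fin d) F)
    (SplitRing F E d) (SplitRing F E d) E
  let e₂ := Algebra.TensorProduct.comm F (SplitRing F E d) E
  exact isReduced_of_injective (e₂.toRingEquiv.toRingHom.comp e₁.toRingEquiv.toRingHom)
    (e₂.injective.comp e₁.injective)

/-- The homomorphism from the split ring given by a point of the affine space and an embedding
of `E`. -/
def splitHom (a : MvPolynomial (Fin d) F →ₐ[F] R) (ι : E →ₐ[F] R) : SplitRing F E d →ₐ[F] R :=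
  Algebra.TensorProduct.lift a ι fun _ _ => Commute.all _ _

omit [Algebra.IsQuadraticExtension F E] in
lemma splitHom_comp (a : MvPolynomial (Fin d) F →ₐ[F] R) (ι : E →ₐ[F] R) :
    (splitHom a ι).comp (IsScalarTower.toAlgHom F (MvPolynomial (Fin d) F) (SplitRing F E d)) =
      a := by
  apply AlgHom.ext
  intro p
  simp [splitHom, Algebra.TensorProduct.algebraMap_apply]

/-- A point of the odd part over the split ring with the universal invariants. -/
lemma exists_section (hF : (2 : F) ≠ 0) (hc : c ≠ AlgEquiv.refl)
    (b₁ : Basis (Fin d) E W₁) (b₂ : Basis (Fin d) E W₂) (hh₁ : h₁.IsSymm)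
    (hn₁ : h₁.Nondegenerate) (hh₂ : h₂.IsSymm) (hn₂ : h₂.Nondegenerate) :
    ∃ s : oddPart (SplitRing F E d) h₁ h₂, ∀ i,
      ((invariantMap hF hc b₁ b₂ hh₁ hn₁ hh₂).app (CommAlgCat.of F (SplitRing F E d)) s :
        Fin d → SplitRing F E d) i = algebraMap (MvPolynomial (Fin d) F) _ (MvPolynomial.X i) := by
  let ι : E →ₐ[F] SplitRing F E d := Algebra.TensorProduct.includeRight
  let q : Fin d → SplitRing F E d :=
    fun i => algebraMap (MvPolynomial (Fin d) F) _ (MvPolynomial.X i)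
  let p : Polynomial (SplitRing F E d) :=
    Polynomial.X ^ d + ∑ i : Fin d, Polynomial.C (q i) * Polynomial.X ^ (i : ℕ)
  have hlt : (∑ i : Fin d, Polynomial.C (q i) * Polynomial.X ^ (i : ℕ)).degree <
      (d : WithBot ℕ) :=
    Polynomial.degree_sum_fin_lt q
  have hp : p.Monic := Polynomial.monic_X_pow_add hlt
  have hd : p.natDegree = d := Polynomial.natDegree_eq_of_degree_eq_some
    (by rw [Polynomial.degree_add_eq_left_of_degree_lt (by rwa [Polynomial.degree_X_pow]),
      Polynomial.degree_X_pow])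
  obtain ⟨M, hM⟩ := exists_charpoly_eq hp hd
  -- With second coordinate `1`, the product of the two coordinates is `M`, whose characteristic
  -- polynomial has the coordinates of `𝔸^d` as coefficients.
  obtain ⟨s, hsA, hsB⟩ := exists_coord b₁ b₂ hF hc hh₁ hn₁ hh₂ hn₂ ι M 1
  refine ⟨s, fun i => ?_⟩
  have hs := charpoly_coord b₁ b₂ ι s
  rw [hsA, hsB, mul_one, hM] at hs
  have e := invariantMap_spec hF hc b₁ b₂ hh₁ hn₁ hh₂ (CommAlgCat.of F (SplitRing F E d)) s i
  have e' := congrArg (contr ι) e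
  rw [contr_tmul, map_one, one_mul] at e'
  refine e'.trans ?_
  have : contr ι ((contraction s.1).charpoly.coeff i) = p.coeff i := by
    rw [hs, Polynomial.coeff_map]
    rfl
  rw [this, Polynomial.coeff_add, Polynomial.coeff_X_pow, if_neg i.2.ne, zero_add,
    Polynomial.finsetSum_coeff]
  simp [Polynomial.coeff_X_pow, Fin.val_inj, q]

/-- A point over the split ring determines points over the polynomial ring. -/
lemma split_injective {z z' : (schemePoints Y).obj (CommAlgCat.of F (MvPolynomial (Fin d) F))}
    (h : (schemePoints Y).map (CommAlgCat.ofHom (IsScalarTower.toAlgHom F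
      (MvPolynomial (Fin d) F) (SplitRing F E d))) z = (schemePoints Y).map (CommAlgCat.ofHom
        (IsScalarTower.toAlgHom F (MvPolynomial (Fin d) F) (SplitRing F E d))) z') : z = z' := by
  have : IsReduced (CommAlgCat.of F (MvPolynomial (Fin d) F)) :=
    inferInstanceAs (IsReduced (MvPolynomial (Fin d) F))
  apply points_ext
  intro K _ _ _ φ
  -- An algebraically closed `K` contains `E`, so each `K`-point of `𝔸^d` extends to the split ring.
  let ι : E →ₐ[F] K := IsAlgClosed.lift
  have key : ∀ w, (schemePoints Y).map (CommAlgCat.ofHom φ) w =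
      (schemePoints Y).map (CommAlgCat.ofHom (splitHom φ ι)) ((schemePoints Y).map
        (CommAlgCat.ofHom (IsScalarTower.toAlgHom F (MvPolynomial (Fin d) F)
          (SplitRing F E d))) w) := fun w => by
    rw [← ConcreteCategory.comp_apply, ← Functor.map_comp, ← CommAlgCat.ofHom_comp, splitHom_comp]
  rw [key, key, h]

/-- The morphism from the affine space given by a point over the polynomial ring. -/
def ofPolynomialPoint (z : (schemePoints Y).obj (CommAlgCat.of F (MvPolynomial (Fin d) F))) :
    affineSpace F d ⟶ schemePoints Y where
  app R := ↾fun (a : Fin d → R) =>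
    (schemePoints Y).map (CommAlgCat.ofHom (MvPolynomial.aeval a)) z
  naturality R S φ := ConcreteCategory.hom_ext _ _ fun (a : Fin d → R) => by
    change (schemePoints Y).map (CommAlgCat.ofHom (MvPolynomial.aeval fun i => φ.hom (a i))) z =
      (schemePoints Y).map φ ((schemePoints Y).map (CommAlgCat.ofHom (MvPolynomial.aeval a)) z)
    have h : CommAlgCat.ofHom (MvPolynomial.aeval fun i => φ.hom (a i)) =
        CommAlgCat.ofHom (MvPolynomial.aeval a : MvPolynomial (Fin d) F →ₐ[F] R) ≫ φ := by
      apply CommAlgCat.hom_ext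
      apply MvPolynomial.algHom_ext
      intro i
      simp
    rw [← ConcreteCategory.comp_apply, ← Functor.map_comp, ← h]

end Quotient

/-! ### Existence and uniqueness of the factorization -/

section Main

open Module

variable {F E : Type u} [Field F] [Field E] [Algebra F E] [Algebra.IsQuadraticExtension F E]
variable {c : E ≃ₐ[F] E}
variable {W₁ W₂ : Type u} [AddCommGroup W₁] [Module E W₁] [Module.Finite E W₁]
  [AddCommGroup W₂] [Module E W₂]
variable {d : ℕ}
variable {h₁ : W₁ →ₛₗ[(c : E →+* E)] W₁ →ₗ[E] E} {h₂ : W₂ →ₛₗ[(c : E →+* E)] W₂ →ₗ[E] E}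

/-- The values of `π` at the points of the odd part. -/
def invariants (hF : (2 : F) ≠ 0) (hc : c ≠ AlgEquiv.refl)
    (b₁ : Basis (Fin d) E W₁) (b₂ : Basis (Fin d) E W₂) (hh₁ : h₁.IsSymm)
    (hn₁ : h₁.Nondegenerate) (hh₂ : h₂.IsSymm) {R : Type u} [CommRing R] [Algebra F R]
    (x : oddPart R h₁ h₂) : Fin d → R :=
  (invariantMap hF hc b₁ b₂ hh₁ hn₁ hh₂).app (CommAlgCat.of F R) x

lemma invariants_oddMap (hF : (2 : F) ≠ 0) (hc : c ≠ AlgEquiv.refl)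
    (b₁ : Basis (Fin d) E W₁) (b₂ : Basis (Fin d) E W₂) (hh₁ : h₁.IsSymm)
    (hn₁ : h₁.Nondegenerate) (hh₂ : h₂.IsSymm) {R S : Type u} [CommRing R] [Algebra F R]
    [CommRing S] [Algebra F S] (φ : R →ₐ[F] S) (x : oddPart R h₁ h₂) (i : Fin d) :
    invariants hF hc b₁ b₂ hh₁ hn₁ hh₂ (oddMap h₁ h₂ φ x) i =
      φ (invariants hF hc b₁ b₂ hh₁ hn₁ hh₂ x i) := by
  have h := ConcreteCategory.congr_hom
    ((invariantMap hF hc b₁ b₂ hh₁ hn₁ hh₂).naturality (CommAlgCat.ofHom φ)) x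
  exact congrFun h i

lemma charpoly_eq_of_invariants_eq (hF : (2 : F) ≠ 0) (hc : c ≠ AlgEquiv.refl)
    (b₁ : Basis (Fin d) E W₁) (b₂ : Basis (Fin d) E W₂) (hh₁ : h₁.IsSymm)
    (hn₁ : h₁.Nondegenerate) (hh₂ : h₂.IsSymm) {R : Type u} [CommRing R] [Algebra F R]
    {x x' : oddPart R h₁ h₂}
    (h : ∀ i, invariants hF hc b₁ b₂ hh₁ hn₁ hh₂ x i = invariants hF hc b₁ b₂ hh₁ hn₁ hh₂ x' i) :
    (contraction x.1).charpoly = (contraction x'.1).charpoly := by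
  rw [charpoly_contraction b₁ b₂, charpoly_contraction b₁ b₂]
  refine charpoly_eq_of_coeff_eq fun i => ?_
  rw [← charpoly_contraction b₁ b₂, ← charpoly_contraction b₁ b₂]
  have e := invariantMap_spec hF hc b₁ b₂ hh₁ hn₁ hh₂ (CommAlgCat.of F R) x i
  have e' := invariantMap_spec hF hc b₁ b₂ hh₁ hn₁ hh₂ (CommAlgCat.of F R) x' i
  exact e.symm.trans ((congrArg _ (h i)).trans e')

/-- Invariant morphisms only depend on the invariants over algebraically closed fields. -/
lemma oddValue_eq_of_invariants_eq (hF : (2 : F) ≠ 0) (hc : c ≠ AlgEquiv.refl)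
    (b₁ : Basis (Fin d) E W₁) (b₂ : Basis (Fin d) E W₂) (hh₁ : h₁.IsSymm)
    (hn₁ : h₁.Nondegenerate) (hh₂ : h₂.IsSymm) (hn₂ : h₂.Nondegenerate)
    {Y : Over (AlgebraicGeometry.Spec (CommRingCat.of F))}
    (f : oddFunctor h₁ h₂ ⟶ schemePoints Y) (hf : (adjointAction h₁ h₂).IsInvariant f)
    {K : Type u} [Field K] [IsAlgClosed K] [Algebra F K] {x x' : oddPart K h₁ h₂}
    (h : ∀ i, invariants hF hc b₁ b₂ hh₁ hn₁ hh₂ x i = invariants hF hc b₁ b₂ hh₁ hn₁ hh₂ x' i) :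
    oddValue f x = oddValue f x' :=
  oddValue_eq_of_charpoly_eq hF hc b₁ b₂ hh₁ hn₁ hh₂ hn₂ f hf
    (charpoly_eq_of_invariants_eq hF hc b₁ b₂ hh₁ hn₁ hh₂ h)

lemma map_comp_apply {Y : Over (AlgebraicGeometry.Spec (CommRingCat.of F))} {R S T : Type u}
    [CommRing R] [Algebra F R] [CommRing S] [Algebra F S] [CommRing T] [Algebra F T]
    (φ : R →ₐ[F] S) (ψ : S →ₐ[F] T) (z : (schemePoints Y).obj (CommAlgCat.of F R)) :
    (schemePoints Y).map (CommAlgCat.ofHom ψ) ((schemePoints Y).map (CommAlgCat.ofHom φ) z) =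
      (schemePoints Y).map (CommAlgCat.ofHom (ψ.comp φ)) z := by
  rw [← ConcreteCategory.comp_apply, ← Functor.map_comp, ← CommAlgCat.ofHom_comp]

omit [Module.Finite E W₁] in
/-- Natural transformations from the odd part to a scheme are equal if they agree on points over
algebraically closed fields. -/
lemma oddFunctor_hom_ext (hF : (2 : F) ≠ 0)
    (b₁ : Basis (Fin d) E W₁) (b₂ : Basis (Fin d) E W₂) (hh₁ : h₁.IsSymm)
    (hh₂ : h₂.IsSymm) (hn₂ : h₂.Nondegenerate)
    {Y : Over (AlgebraicGeometry.Spec (CommRingCat.of F))}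
    {f g : oddFunctor h₁ h₂ ⟶ schemePoints Y}
    (H : ∀ (K : Type u) [Field K] [IsAlgClosed K] [Algebra F K] (x : oddPart K h₁ h₂),
      oddValue f x = oddValue g x) : f = g := by
  ext R x
  -- `R` may have nilpotents; by naturality it suffices to compare the values at the lift over the
  -- reduced algebra `A`.
  obtain ⟨A, _, _, _, θ, y, rfl⟩ := exists_reduced_lift (R := R) hF b₁ b₂ hh₁ hh₂ hn₂ x
  change oddValue f (oddMap h₁ h₂ θ y) = oddValue g (oddMap h₁ h₂ θ y)
  rw [oddValue_oddMap, oddValue_oddMap]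
  congr 1
  have : IsReduced (CommAlgCat.of F A) := ‹IsReduced A›
  apply points_ext
  intro K _ _ _ φ
  have := H K (oddMap h₁ h₂ φ y)
  rwa [oddValue_oddMap, oddValue_oddMap] at this

lemma exists_factor (hF : (2 : F) ≠ 0) (hc : c ≠ AlgEquiv.refl)
    (b₁ : Basis (Fin d) E W₁) (b₂ : Basis (Fin d) E W₂) (hh₁ : h₁.IsSymm)
    (hn₁ : h₁.Nondegenerate) (hh₂ : h₂.IsSymm) (hn₂ : h₂.Nondegenerate)
    {Y : Over (AlgebraicGeometry.Spec (CommRingCat.of F))}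
    (f : oddFunctor h₁ h₂ ⟶ schemePoints Y) (hf : (adjointAction h₁ h₂).IsInvariant f) :
    ∃ φ : affineSpace F d ⟶ schemePoints Y,
      invariantMap hF hc b₁ b₂ hh₁ hn₁ hh₂ ≫ φ = f := by
  obtain ⟨s, hs⟩ := exists_section (h₁ := h₁) hF hc b₁ b₂ hh₁ hn₁ hh₂ hn₂
  replace hs : ∀ i, invariants hF hc b₁ b₂ hh₁ hn₁ hh₂ s i =
    algebraMap (MvPolynomial (Fin d) F) _ (MvPolynomial.X i) := hs
  have := isReduced_splitRing_tensor (d := d) hF hc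
  -- Two geometric points of the split ring over the same point of `𝔸^d` send `s` to points with the
  -- same invariants, where `f` takes the same value.
  obtain ⟨z, hz⟩ := exists_points_descent (A := MvPolynomial (Fin d) F) (oddValue f s)
    (fun K _ _ _ φ ψ h => by
      rw [← oddValue_oddMap, ← oddValue_oddMap]
      refine oddValue_eq_of_invariants_eq hF hc b₁ b₂ hh₁ hn₁ hh₂ hn₂ f hf fun i => ?_
      rw [invariants_oddMap, invariants_oddMap, hs, h])
  refine ⟨ofPolynomialPoint z, oddFunctor_hom_ext hF b₁ b₂ hh₁ hh₂ hn₂ fun K _ _ _ x => ?_⟩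
  let ι : E →ₐ[F] K := IsAlgClosed.lift
  let a : MvPolynomial (Fin d) F →ₐ[F] K :=
    MvPolynomial.aeval (invariants hF hc b₁ b₂ hh₁ hn₁ hh₂ x)
  change (schemePoints Y).map (CommAlgCat.ofHom a) z = oddValue f x
  -- The value of `φ` at `π(x)` is the value of `f` at the specialization of `s` along `splitHom a
  -- ι`, a point with the same invariants as `x`.
  rw [← splitHom_comp a ι, ← map_comp_apply, hz, ← oddValue_oddMap]
  refine oddValue_eq_of_invariants_eq hF hc b₁ b₂ hh₁ hn₁ hh₂ hn₂ f hf fun i => ?_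
  rw [invariants_oddMap, hs]
  have : splitHom a ι (algebraMap (MvPolynomial (Fin d) F) _ (MvPolynomial.X i)) =
      a (MvPolynomial.X i) := AlgHom.congr_fun (splitHom_comp a ι) _
  rw [this, MvPolynomial.aeval_X]

/-- By Yoneda a morphism from `𝔸^d` is determined by its value at the universal point. Over the
split ring this point is `π(s)`, where the two morphisms agree, and `split_injective` descends the
equality. -/
lemma factor_unique (hF : (2 : F) ≠ 0) (hc : c ≠ AlgEquiv.refl)
    (b₁ : Basis (Fin d) E W₁) (b₂ : Basis (Fin d) E W₂) (hh₁ : h₁.IsSymm)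
    (hn₁ : h₁.Nondegenerate) (hh₂ : h₂.IsSymm) (hn₂ : h₂.Nondegenerate)
    {Y : Over (AlgebraicGeometry.Spec (CommRingCat.of F))}
    {φ ψ : affineSpace F d ⟶ schemePoints Y}
    (h : invariantMap hF hc b₁ b₂ hh₁ hn₁ hh₂ ≫ φ = invariantMap hF hc b₁ b₂ hh₁ hn₁ hh₂ ≫ ψ) :
    φ = ψ := by
  have nat : ∀ (χ : affineSpace F d ⟶ schemePoints Y) {R S : Type u} [CommRing R] [Algebra F R]
      [CommRing S] [Algebra F S] (θ : R →ₐ[F] S) (a : Fin d → R),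
      χ.app (CommAlgCat.of F S) (fun i => θ (a i)) =
        (schemePoints Y).map (CommAlgCat.ofHom θ) (χ.app (CommAlgCat.of F R) a) := by
    intro χ R S _ _ _ _ θ a
    have h := ConcreteCategory.congr_hom (χ.naturality (CommAlgCat.ofHom θ)) a
    exact h
  obtain ⟨s, hs⟩ := exists_section (h₁ := h₁) hF hc b₁ b₂ hh₁ hn₁ hh₂ hn₂
  have key : φ.app (CommAlgCat.of F (MvPolynomial (Fin d) F)) MvPolynomial.X =
      ψ.app (CommAlgCat.of F (MvPolynomial (Fin d) F)) MvPolynomial.X := by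
    apply split_injective (E := E)
    rw [← nat, ← nat]
    have e : (fun i => IsScalarTower.toAlgHom F (MvPolynomial (Fin d) F) (SplitRing F E d)
        (MvPolynomial.X i)) = invariants hF hc b₁ b₂ hh₁ hn₁ hh₂ s := funext fun i => (hs i).symm
    rw [e]
    have h' := NatTrans.congr_app h (CommAlgCat.of F (SplitRing F E d))
    have h'' := ConcreteCategory.congr_hom h' s
    exact h''
  ext R a
  have e : (a : Fin d → R) = fun i => (MvPolynomial.aeval a : MvPolynomial (Fin d) F →ₐ[F] R)
    (MvPolynomial.X i) := funext fun i => (MvPolynomial.aeval_X _ _).symm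
  have h1 := nat φ (MvPolynomial.aeval a : MvPolynomial (Fin d) F →ₐ[F] R) MvPolynomial.X
  have h2 := nat ψ (MvPolynomial.aeval a : MvPolynomial (Fin d) F →ₐ[F] R) MvPolynomial.X
  rw [key, ← h2, ← e] at h1
  exact h1

lemma invariantMap_isInvariant (hF : (2 : F) ≠ 0) (hc : c ≠ AlgEquiv.refl)
    (b₁ : Basis (Fin d) E W₁) (b₂ : Basis (Fin d) E W₂) (hh₁ : h₁.IsSymm)
    (hn₁ : h₁.Nondegenerate) (hh₂ : h₂.IsSymm) :
    (adjointAction h₁ h₂).IsInvariant (invariantMap hF hc b₁ b₂ hh₁ hn₁ hh₂) := by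
  intro R g x
  refine funext fun i => one_tmul_injective (F := F) (E := E) ?_
  refine (invariantMap_spec hF hc b₁ b₂ hh₁ hn₁ hh₂ R (adjoint h₁ h₂ g x) i).trans ?_
  refine (congrArg (fun p => p.coeff (i : ℕ))
    (charpoly_contraction_adjoint (R := R) (h₁ := h₁) (h₂ := h₂) g x)).trans ?_
  exact (invariantMap_spec hF hc b₁ b₂ hh₁ hn₁ hh₂ R x i).symm

end Main
end UnitaryPair
end

theorem mainTheorem7 {F E : Type u} [Field F] [Field E] [Algebra F E]
    [Algebra.IsQuadraticExtension F E] (hF : (2 : F) ≠ 0)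
    (c : E ≃ₐ[F] E) (hc : c ≠ AlgEquiv.refl)
    {W₁ W₂ : Type u} [AddCommGroup W₁] [Module E W₁] [Module.Finite E W₁]
    [AddCommGroup W₂] [Module E W₂] [Module.Finite E W₂]
    (d : ℕ) (hW₁ : Module.finrank E W₁ = d) (hW₂ : Module.finrank E W₂ = d)
    (h₁ : W₁ →ₛₗ[(c : E →+* E)] W₁ →ₗ[E] E) (hh₁ : h₁.IsSymm) (hn₁ : h₁.Nondegenerate)
    (h₂ : W₂ →ₛₗ[(c : E →+* E)] W₂ →ₗ[E] E) (hh₂ : h₂.IsSymm) (hn₂ : h₂.Nondegenerate) :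
    ∃ π : UnitaryPair.oddFunctor h₁ h₂ ⟶ UnitaryPair.affineSpace F d,
      (∀ (R : CommAlgCat.{u} F) (x : UnitaryPair.oddPart R h₁ h₂) (i : Fin d),
        (1 : E) ⊗ₜ[F] (π.app R x : Fin d → R) i =
          (LinearMap.charpoly (UnitaryPair.contraction x.1)).coeff (i : ℕ)) ∧
      (UnitaryPair.adjointAction h₁ h₂).IsCategoricalQuotient π := by
  let b₁ := Module.finBasisOfFinrankEq E W₁ hW₁
  let b₂ := Module.finBasisOfFinrankEq E W₂ hW₂
  refine ⟨UnitaryPair.invariantMap hF hc b₁ b₂ hh₁ hn₁ hh₂,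
    UnitaryPair.invariantMap_spec hF hc b₁ b₂ hh₁ hn₁ hh₂,
    UnitaryPair.invariantMap_isInvariant hF hc b₁ b₂ hh₁ hn₁ hh₂, fun Y f hf => ?_⟩
  obtain ⟨φ, hφ⟩ := UnitaryPair.exists_factor hF hc b₁ b₂ hh₁ hn₁ hh₂ hn₂ f hf
  exact ⟨φ, hφ, fun ψ hψ =>
    UnitaryPair.factor_unique hF hc b₁ b₂ hh₁ hn₁ hh₂ hn₂ (hψ.trans hφ.symm)⟩
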